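/- Let $q\ge 0$ be an integer and let $S,F$ be real $q\times q$ matrices such that $S$ and $V:=S-FSF'$ are (symmetric) positive definite. For $\delta>0$ and a positive definite $p\times p$ matrix $D$, let $\mathrm{IW}_p(\delta,D)$ denote the inverse Wishart distribution whose density with respect to Lebesgue measure $\prod_{i\le j}dA_{ij}$ on symmetric matrices is supported on the positive definite matrices $A$ and proportional there to $|A|^{-(\delta+2p)/2}\exp\{-\tfrac12\mathrm{tr}(DA^{-1})\}$. For real $n>0$, an IW-AR(1) process with parameters $(n,F,S)$ is a first-order Markov sequence $(\Sigma_t)_{t\ge 0}$ of random $q\times q$ matrices such that for every $t\ge 1$ the pair $(\Sigma_{t-1},\Sigma_t)$ has the law of the two diagonal $q\times q$ blocks of a $2q\times 2q$ random matrix with distribution $$\mathrm{IW}_{2q}\left(n+2,\; n\begin{pmatrix} S & SF'\\ FS & S\end{pmatrix}\right).$$ (a) For every real $n>0$, every such process and every $t\ge 1$, the entries of $\Sigma_t$ are integrable and, almost surely, $$E[\Sigma_t\mid\Sigma_{t-1}] = F\Sigma_{t-1}F' + c_{n,q}\left[1+\mathrm{tr}\{\Sigma_{t-1}(nS)^{-1}\}\right]V,\qquad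 c_{n,q}=\frac{n}{n+q}.$$ (b) As $n\to\infty$ with $F,S$ and the value of $\Sigma_{t-1}$ fixed, the conditional mean tends to $S+F(\Sigma_{t-1}-S)F'$. That is: (i) for every real $q\times q$ matrix $A$, $FAF'+c_{n,q}[1+\mathrm{tr}\{A(nS)^{-1}\}]V\to S+F(A-S)F'$ as $n\to\infty$; and (ii) if $n_k>0$, $n_k\to\infty$, and for each $k$ the measurable function $g_k$ is any version of the regression function $A\mapsto E[\Sigma_t\mid\Sigma_{t-1}=A]$ of an IW-AR(1) process with parameters $(n_k,F,S)$, then $g_k(A)\to S+F(A-S)F'$ for Lebesgue-almost every positive definite $A$. -/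

import Mathlib

open Matrix MeasureTheory ProbabilityTheory Filter Topology

noncomputable section

/-- The product (equivalently, Borel) sigma-algebra on real matrices. -/
instance instMeasurableSpaceRealMatrix {ι κ : Type*} : MeasurableSpace (Matrix ι κ ℝ) :=
  inferInstanceAs (MeasurableSpace (ι → κ → ℝ))

/-- The symmetric matrix with prescribed entries `x s(i, j)`, one real number for each unordered
pair of indices (diagonal included). -/
def symMatrix (ι : Type*) (x : Sym2 ι → ℝ) : Matrix ι ι ℝ :=
  Matrix.of fun i j => x s(i, j)

/-- Lebesgue measure `∏_{i ≤ j} dA_{ij}` on the symmetric real matrices, viewed as a measure on all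
square matrices. -/
def symLebesgue (ι : Type*) [Fintype ι] [DecidableEq ι] : Measure (Matrix ι ι ℝ) :=
  (volume : Measure (Sym2 ι → ℝ)).map (symMatrix ι)

/-- The multivariate gamma function
`Γ_p(a) = π^{p(p-1)/4} ∏_{j=1}^{p} Γ(a + (1 - j)/2)` (the index below is `j - 1`). -/
def multiGamma (p : ℕ) (a : ℝ) : ℝ :=
  Real.pi ^ ((p : ℝ) * ((p : ℝ) - 1) / 4) * ∏ j ∈ Finset.range p, Real.Gamma (a - (j : ℝ) / 2)

open scoped Classical in
/-- The density of the inverse Wishart distribution `IW_p(δ, D)` (`p` the number of indices) with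
respect to Lebesgue measure on symmetric matrices.  The parametrization is the one in which `δ` is
unchanged under passing to principal submatrices and the mean is `D / (δ - 2)` for `δ > 2`; the
Wishart distribution of the inverse matrix has `δ + p - 1` degrees of freedom. -/
def invWishartDensity {ι : Type*} [Fintype ι] [DecidableEq ι] (δ : ℝ) (D : Matrix ι ι ℝ)
    (A : Matrix ι ι ℝ) : ℝ :=
  if A.PosDef then
    D.det ^ ((δ + (Fintype.card ι : ℝ) - 1) / 2) /
        ((2 : ℝ) ^ ((Fintype.card ι : ℝ) * (δ + (Fintype.card ι : ℝ) - 1) / 2) *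
          multiGamma (Fintype.card ι) ((δ + (Fintype.card ι : ℝ) - 1) / 2)) *
      A.det ^ (-(δ + 2 * (Fintype.card ι : ℝ)) / 2) * Real.exp (-(D * A⁻¹).trace / 2)
  else 0

/-- The inverse Wishart distribution `IW_p(δ, D)`, for `δ > 0` and `D` positive definite. -/
def invWishart {ι : Type*} [Fintype ι] [DecidableEq ι] (δ : ℝ) (D : Matrix ι ι ℝ) :
    Measure (Matrix ι ι ℝ) :=
  (symLebesgue ι).withDensity fun A => ENNReal.ofReal (invWishartDensity δ D A)

/-- The joint law of two consecutive states of the IW-AR(1) process: the law of the two diagonal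
blocks of a `2q × 2q` matrix with distribution
`IW_{2q}(n + 2, n [[S, S F'], [F S, S]])`. -/
def iwarPairLaw {q : ℕ} (n : ℝ) (F S : Matrix (Fin q) (Fin q) ℝ) :
    Measure (Matrix (Fin q) (Fin q) ℝ × Matrix (Fin q) (Fin q) ℝ) :=
  (invWishart (n + 2) (n • Matrix.fromBlocks S (S * Fᵀ) (F * S) S)).map
    fun M => (M.toBlocks₁₁, M.toBlocks₂₂)

/-- `X 0, X 1, X 2, …` is an IW-AR(1) process with parameters `n, F, S` under `P`: a first-order
Markov sequence of random `q × q` matrices in which every pair of consecutive matrices has the law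
`iwarPairLaw n F S`. -/
structure IsIWAR1 {q : ℕ} {Ω : Type*} [MeasurableSpace Ω] (P : Measure Ω) (n : ℝ)
    (F S : Matrix (Fin q) (Fin q) ℝ) (X : ℕ → Ω → Matrix (Fin q) (Fin q) ℝ) : Prop where
  measurable : ∀ t, Measurable (X t)
  pair_law : ∀ t, P.map (fun ω => (X t ω, X (t + 1) ω)) = iwarPairLaw n F S
  markov : ∀ t, ∀ B : Set (Matrix (Fin q) (Fin q) ℝ), MeasurableSet B →
    P⟦X (t + 1) ⁻¹' B | ⨆ s ≤ t, MeasurableSpace.comap (X s) inferInstance⟧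
      =ᵐ[P] P⟦X (t + 1) ⁻¹' B | MeasurableSpace.comap (X t) inferInstance⟧

end

noncomputable section

open scoped ENNReal NNReal

/-! ### Measurability on spaces of real matrices -/

/-! Write a positive definite block matrix through its leading block `A`, the regression coefficient
`Γ = B A⁻¹` and the Schur complement `C`. Its lower right block is then `C + Γ A Γᵀ`. When the scale
matrix is written in the same way through `P`, `F`, `V`, the inverse Wishart density times the
Jacobian splits (`invWishartKernel_schurMatrix`) into a factor in `A` alone and a factor in `(Γ, C)`
alone. So `(Γ, C)` is independent of `A`, and the conditional mean of the lower right block is the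
mean of `C + Γ A Γᵀ` with `A` frozen.

It is enough to know the mean of each quadratic form `vᵀ (·) v`. Linear images of full row rank of
an inverse Wishart matrix are again inverse Wishart
(`exists_lintegral_invWishartKernel_compression`), so the second block may be compressed to a single
entry, where `C` is a number `x > 0`. Given `x`, the row `Γ` is Gaussian with mean `F` and
covariance `x P⁻¹`, hence `x + Γ A Γᵀ` has mean `F A Fᵀ + x (1 + tr (A P⁻¹))`. Integrating `Γ` out
leaves `x` inverse gamma with mean `V / (δ + q - 2)`. With `δ = n + 2`, `P = n S` and Schur
complement `n (S - F S Fᵀ)`, this is the stated formula; polarization recovers the entries.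

No normalizing constant is computed. Each change of variables is stated with an unspecified constant
in `ℝ≥0∞` that does not depend on the test function, so it is common to the integrals being
compared.

For the limit along arbitrary versions, each version agrees almost surely with the formula. The law
of a state has a density that is positive on positive definite matrices, so the agreement holds
Lebesgue-almost everywhere there. -/

instance instBorelSpaceRealMatrix {ι κ : Type*} [Countable ι] [Countable κ] :
    BorelSpace (Matrix ι κ ℝ) :=
  inferInstanceAs (BorelSpace (ι → κ → ℝ))

instance instSecondCountableTopologyRealMatrix {ι κ : Type*} [Countable ι] [Countable κ] :
    SecondCountableTopology (Matrix ι κ ℝ) :=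
  inferInstanceAs (SecondCountableTopology (ι → κ → ℝ))

section Measurability

variable {ι κ α : Type*}

theorem Matrix.measurable_entry (i : ι) (j : κ) : Measurable fun A : Matrix ι κ ℝ => A i j :=
  (measurable_pi_apply (X := fun _ : κ => ℝ) j).comp (measurable_pi_apply (X := fun _ : ι => κ → ℝ) i)

theorem Matrix.measurable_of_entries [MeasurableSpace α] {f : α → Matrix ι κ ℝ}
    (h : ∀ i j, Measurable fun a => f a i j) : Measurable f :=
  measurable_pi_lambda (X := fun _ : ι => κ → ℝ) _ fun i => measurable_pi_lambda _ fun j => h i j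

theorem Matrix.measurable_inv [Fintype ι] [DecidableEq ι] :
    Measurable fun A : Matrix ι ι ℝ => A⁻¹ := by
  refine Matrix.measurable_of_entries fun i j => ?_
  simp only [Matrix.inv_def, Matrix.smul_apply, smul_eq_mul, Ring.inverse_eq_inv']
  have h1 : Measurable fun A : Matrix ι ι ℝ => A.det := Continuous.measurable (by fun_prop)
  have h2 : Measurable fun A : Matrix ι ι ℝ => A.adjugate :=
    Continuous.measurable (Continuous.matrix_adjugate continuous_id)
  exact h1.inv.mul ((Matrix.measurable_entry i j).comp h2)

/-- Semidefiniteness is an uncountable intersection of conditions, but of closed ones; a nonzero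
determinant then upgrades it to definiteness. -/
theorem Matrix.measurableSet_posDef [Fintype ι] [DecidableEq ι] :
    MeasurableSet {A : Matrix ι ι ℝ | A.PosDef} := by
  have hset : {A : Matrix ι ι ℝ | A.PosDef} =
      {A : Matrix ι ι ℝ | Aᵀ = A} ∩ (⋂ x : ι → ℝ, {A | 0 ≤ x ⬝ᵥ (A *ᵥ x)}) ∩ {A | A.det ≠ 0} := by
    ext A
    constructor
    · intro h
      refine ⟨⟨?_, ?_⟩, h.det_pos.ne'⟩
      · simpa [Matrix.IsHermitian] using h.isHermitian
      · simp only [Set.mem_iInter]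
        intro x
        simpa using h.posSemidef.dotProduct_mulVec_nonneg x
    · rintro ⟨⟨h1, h2⟩, h3⟩
      have h4 : A.PosSemidef := by
        refine .of_dotProduct_mulVec_nonneg (by simpa [Matrix.IsHermitian] using h1) fun x => ?_
        simp only [Set.mem_iInter] at h2
        simpa using h2 x
      exact h4.posDef_iff_det_ne_zero.2 h3
  rw [hset]
  refine MeasurableSet.inter (MeasurableSet.inter ?_ ?_) ?_
  · exact (isClosed_eq (by fun_prop) continuous_id).measurableSet
  · exact (isClosed_iInter fun x => isClosed_le continuous_const (by fun_prop)).measurableSet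
  · exact (isOpen_ne_fun (by fun_prop) continuous_const).measurableSet

end Measurability

/-! ### Lebesgue measure on symmetric matrices -/

section SymLebesgue

theorem symMatrix_apply {ι : Type*} (x : Sym2 ι → ℝ) (i j : ι) :
    symMatrix ι x i j = x s(i, j) := rfl

theorem symMatrix_transpose {ι : Type*} (x : Sym2 ι → ℝ) : (symMatrix ι x)ᵀ = symMatrix ι x := by
  ext i j
  simp only [transpose_apply, symMatrix_apply, Sym2.eq_swap]

theorem measurable_symMatrix (ι : Type*) : Measurable (symMatrix ι) :=
  Matrix.measurable_of_entries fun _ _ => measurable_pi_apply _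

/-- The entries of a matrix on and above the diagonal, indexed by unordered pairs; on symmetric
matrices this inverts `symMatrix`. -/
def symEntries {ι : Type*} (A : Matrix ι ι ℝ) : Sym2 ι → ℝ :=
  Sym2.lift ⟨fun i j => (A i j + A j i) / 2, fun i j => by simp only [add_comm]⟩

theorem symEntries_symMatrix {ι : Type*} (x : Sym2 ι → ℝ) : symEntries (symMatrix ι x) = x := by
  ext s
  induction s with
  | _ i j =>
    simp only [symEntries, Sym2.lift_mk, symMatrix_apply, Sym2.eq_swap (a := j)]
    ring

theorem symMatrix_symEntries {ι : Type*} {A : Matrix ι ι ℝ} (h : Aᵀ = A) :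
    symMatrix ι (symEntries A) = A := by
  ext i j
  have : A j i = A i j := congrFun (congrFun h i) j
  simp only [symEntries, Sym2.lift_mk, symMatrix_apply, this]
  ring

/-- The off-diagonal and diagonal blocks of a symmetric matrix as coordinates. -/
def symBlocksEquiv (ι κ : Type*) :
    ((Sym2 ι → ℝ) × (κ → ι → ℝ) × (Sym2 κ → ℝ)) ≃ₗ[ℝ] (Sym2 (ι ⊕ κ) → ℝ) where
  toFun p := symEntries
    (fromBlocks (symMatrix ι p.1) (Matrix.of p.2.1)ᵀ (Matrix.of p.2.1) (symMatrix κ p.2.2))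
  invFun y := (fun s => y (s.map Sum.inl), fun k i => y s(Sum.inr k, Sum.inl i),
    fun s => y (s.map Sum.inr))
  map_add' p p' := by
    ext s
    induction s with
    | _ i j =>
      rcases i with i | i <;> rcases j with j | j <;>
        simp [symEntries, symMatrix_apply] <;> ring
  map_smul' a p := by
    ext s
    induction s with
    | _ i j =>
      rcases i with i | i <;> rcases j with j | j <;>
        simp [symEntries, symMatrix_apply] <;> ring
  left_inv p := by
    refine Prod.ext ?_ (Prod.ext ?_ ?_)
    · ext s
      induction s with
      | _ i j => simp [symEntries, symMatrix_apply, Sym2.eq_swap (a := j)]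
    · ext k i
      simp [symEntries]
    · ext s
      induction s with
      | _ i j => simp [symEntries, symMatrix_apply, Sym2.eq_swap (a := j)]
  right_inv y := by
    ext s
    induction s with
    | _ i j =>
      rcases i with i | i <;> rcases j with j | j
      · simp [symEntries, symMatrix_apply, Sym2.eq_swap (a := j)]
      · simp [symEntries, Sym2.eq_swap (a := Sum.inl i)]
      · simp [symEntries]
      · simp [symEntries, symMatrix_apply, Sym2.eq_swap (a := j)]

theorem symMatrix_symBlocksEquiv {ι κ : Type*} (p : (Sym2 ι → ℝ) × (κ → ι → ℝ) × (Sym2 κ → ℝ)) :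
    symMatrix (ι ⊕ κ) (symBlocksEquiv ι κ p) =
      fromBlocks (symMatrix ι p.1) (Matrix.of p.2.1)ᵀ (Matrix.of p.2.1) (symMatrix κ p.2.2) :=
  symMatrix_symEntries (by simp [fromBlocks_transpose, symMatrix_transpose])

theorem measurable_fromBlocks_symm {ι κ α : Type*} [MeasurableSpace α] {A : α → Matrix ι ι ℝ}
    {B : α → Matrix κ ι ℝ} {C : α → Matrix κ κ ℝ} (hA : Measurable A) (hB : Measurable B)
    (hC : Measurable C) : Measurable fun a => fromBlocks (A a) (B a)ᵀ (B a) (C a) := by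
  refine Matrix.measurable_of_entries fun i j => ?_
  rcases i with i | i <;> rcases j with j | j
  · exact (Matrix.measurable_entry i j).comp hA
  · exact (Matrix.measurable_entry j i).comp hB
  · exact (Matrix.measurable_entry i j).comp hB
  · exact (Matrix.measurable_entry i j).comp hC

theorem measurable_matrixOf {ι κ : Type*} : Measurable fun B : κ → ι → ℝ => (Matrix.of B : Matrix κ ι ℝ) :=
  measurable_id

variable {ι κ : Type*} [Fintype ι] [DecidableEq ι] [Fintype κ] [DecidableEq κ]

instance : SFinite (symLebesgue ι) := by unfold symLebesgue; infer_instance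

theorem lintegral_symLebesgue {f : Matrix ι ι ℝ → ℝ≥0∞} (hf : Measurable f) :
    ∫⁻ A, f A ∂symLebesgue ι = ∫⁻ x, f (symMatrix ι x) :=
  lintegral_map hf (measurable_symMatrix ι)

/-- A linear isomorphism onto `τ → ℝ` transports any Haar measure to a multiple of Lebesgue
measure. -/
theorem exists_lintegral_eq_mul_comp_linearEquiv {E τ : Type*} [Fintype τ] [NormedAddCommGroup E]
    [NormedSpace ℝ E] [MeasurableSpace E] [BorelSpace E] [FiniteDimensional ℝ E]
    (μ : Measure E) [μ.IsAddHaarMeasure] (e : E ≃ₗ[ℝ] (τ → ℝ)) :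
    ∃ c : ℝ≥0∞, ∀ f : (τ → ℝ) → ℝ≥0∞, Measurable f → ∫⁻ x, f x = c * ∫⁻ y, f (e y) ∂μ := by
  let L := e.toContinuousLinearEquiv
  have : (μ.map L).IsAddHaarMeasure := L.isAddHaarMeasure_map μ
  refine ⟨(volume : Measure (τ → ℝ)).addHaarScalarFactor (μ.map L), fun f hf => ?_⟩
  -- Uniqueness of Haar measure supplies the factor, so no determinant has to be computed.
  have h := Measure.isAddLeftInvariant_eq_smul (volume : Measure (τ → ℝ)) (μ.map L)
  conv_lhs => rw [h]
  have hL : Measurable L := L.continuous.measurable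
  rw [lintegral_smul_measure, lintegral_map hf hL]
  rfl

/-- Congruence by an invertible matrix changes Lebesgue measure on symmetric matrices by a
constant factor. -/
theorem exists_lintegral_symLebesgue_congruence (L : Matrix κ ι ℝ) (L' : Matrix ι κ ℝ)
    (h1 : L * L' = 1) (h2 : L' * L = 1) :
    ∃ c : ℝ≥0∞, ∀ f : Matrix κ κ ℝ → ℝ≥0∞, Measurable f →
      ∫⁻ A, f A ∂symLebesgue κ = c * ∫⁻ A, f (L * A * Lᵀ) ∂symLebesgue ι := by
  have h1' : L'ᵀ * Lᵀ = 1 := by rw [← transpose_mul, h1, transpose_one]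
  have h2' : Lᵀ * L'ᵀ = 1 := by rw [← transpose_mul, h2, transpose_one]
  have hsym (x : Sym2 ι → ℝ) : (L * symMatrix ι x * Lᵀ)ᵀ = L * symMatrix ι x * Lᵀ := by
    simp [transpose_mul, symMatrix_transpose, Matrix.mul_assoc]
  have hsym' (x : Sym2 κ → ℝ) : (L' * symMatrix κ x * L'ᵀ)ᵀ = L' * symMatrix κ x * L'ᵀ := by
    simp [transpose_mul, symMatrix_transpose, Matrix.mul_assoc]
  let e : (Sym2 ι → ℝ) ≃ₗ[ℝ] (Sym2 κ → ℝ) :=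
    { toFun := fun x => symEntries (L * symMatrix ι x * Lᵀ)
      invFun := fun y => symEntries (L' * symMatrix κ y * L'ᵀ)
      map_add' := fun x y => by
        have : symMatrix ι (x + y) = symMatrix ι x + symMatrix ι y := rfl
        ext s
        induction s with
        | _ i j =>
          simp only [symEntries, this, Matrix.mul_add, Matrix.add_mul, Sym2.lift_mk,
            Matrix.add_apply, Pi.add_apply]
          ring
      map_smul' := fun a x => by
        have : symMatrix ι (a • x) = a • symMatrix ι x := rfl
        ext s
        induction s with
        | _ i j =>
          simp only [symEntries, this, Matrix.mul_smul, Matrix.smul_mul, Sym2.lift_mk,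
            Matrix.smul_apply, Pi.smul_apply, smul_eq_mul, RingHom.id_apply]
          ring
      left_inv := fun x => by
        have : L' * (L * symMatrix ι x * Lᵀ) * L'ᵀ = symMatrix ι x := by
          rw [Matrix.mul_assoc, Matrix.mul_assoc, h2', Matrix.mul_one, ← Matrix.mul_assoc, h2,
            Matrix.one_mul]
        simp only
        rw [symMatrix_symEntries (hsym x), this, symEntries_symMatrix]
      right_inv := fun x => by
        have : L * (L' * symMatrix κ x * L'ᵀ) * Lᵀ = symMatrix κ x := by
          rw [Matrix.mul_assoc, Matrix.mul_assoc, h1', Matrix.mul_one, ← Matrix.mul_assoc, h1,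
            Matrix.one_mul]
        simp only
        rw [symMatrix_symEntries (hsym' x), this, symEntries_symMatrix] }
  have he (x : Sym2 ι → ℝ) : symMatrix κ (e x) = L * symMatrix ι x * Lᵀ :=
    symMatrix_symEntries (hsym x)
  obtain ⟨c, hc⟩ := exists_lintegral_eq_mul_comp_linearEquiv volume e
  refine ⟨c, fun f hf => ?_⟩
  have hm : Measurable fun A : Matrix ι ι ℝ => f (L * A * Lᵀ) :=
    hf.comp (Continuous.measurable (by fun_prop))
  rw [lintegral_symLebesgue hf, lintegral_symLebesgue hm,
    hc (fun x => f (symMatrix κ x)) (hf.comp (measurable_symMatrix κ))]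
  simp only [he]

/-- Lebesgue measure on symmetric matrices in block coordinates. -/
theorem exists_lintegral_symLebesgue_sum (ι κ : Type*) [Fintype ι] [DecidableEq ι] [Fintype κ]
    [DecidableEq κ] :
    ∃ c : ℝ≥0∞, ∀ f : Matrix (ι ⊕ κ) (ι ⊕ κ) ℝ → ℝ≥0∞, Measurable f →
      ∫⁻ M, f M ∂symLebesgue (ι ⊕ κ) =
        c * ∫⁻ A, (∫⁻ B : κ → ι → ℝ, (∫⁻ C, f (fromBlocks A (Matrix.of B)ᵀ (Matrix.of B) C)
          ∂symLebesgue κ)) ∂symLebesgue ι := by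
  have : (volume : Measure (κ → ι → ℝ)).IsAddHaarMeasure :=
    Measure.pi.isAddHaarMeasure (fun _ : κ => (volume : Measure (ι → ℝ)))
  have : ((volume : Measure (κ → ι → ℝ)).prod
      (volume : Measure (Sym2 κ → ℝ))).IsAddHaarMeasure :=
    Measure.prod.instIsAddHaarMeasure _ _
  have : ((volume : Measure (Sym2 ι → ℝ)).prod
      ((volume : Measure (κ → ι → ℝ)).prod (volume : Measure (Sym2 κ → ℝ)))).IsAddHaarMeasure :=
    Measure.prod.instIsAddHaarMeasure _ _
  obtain ⟨c, hc⟩ := exists_lintegral_eq_mul_comp_linearEquiv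
    ((volume : Measure (Sym2 ι → ℝ)).prod
      ((volume : Measure (κ → ι → ℝ)).prod (volume : Measure (Sym2 κ → ℝ)))) (symBlocksEquiv ι κ)
  refine ⟨c, fun f hf => ?_⟩
  rw [lintegral_symLebesgue hf,
    hc (fun x => f (symMatrix _ x)) (hf.comp (measurable_symMatrix _))]
  congr 1
  simp only [symMatrix_symBlocksEquiv]
  have hm : Measurable fun p : Matrix ι ι ℝ × (κ → ι → ℝ) × Matrix κ κ ℝ =>
      f (fromBlocks p.1 (Matrix.of p.2.1)ᵀ (Matrix.of p.2.1) p.2.2) :=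
    hf.comp (measurable_fromBlocks_symm measurable_fst
      (measurable_matrixOf.comp (measurable_fst.comp measurable_snd))
      (measurable_snd.comp measurable_snd))
  have hm' : Measurable fun p : (Matrix ι ι ℝ × (κ → ι → ℝ)) × Matrix κ κ ℝ =>
      f (fromBlocks p.1.1 (Matrix.of p.1.2)ᵀ (Matrix.of p.1.2) p.2) :=
    hm.comp (measurable_fst.fst.prodMk (measurable_fst.snd.prodMk measurable_snd))
  have hout : Measurable fun A : Matrix ι ι ℝ => ∫⁻ B : κ → ι → ℝ, ∫⁻ C,
      f (fromBlocks A (Matrix.of B)ᵀ (Matrix.of B) C) ∂symLebesgue κ :=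
    (hm'.lintegral_prod_right').lintegral_prod_right'
  rw [lintegral_symLebesgue hout]
  have hs : Measurable fun p : (Sym2 ι → ℝ) × (κ → ι → ℝ) × (Sym2 κ → ℝ) =>
      f (fromBlocks (symMatrix ι p.1) (Matrix.of p.2.1)ᵀ (Matrix.of p.2.1)
        (symMatrix κ p.2.2)) :=
    hm.comp (((measurable_symMatrix ι).comp measurable_fst).prodMk
      (measurable_snd.fst.prodMk ((measurable_symMatrix κ).comp measurable_snd.snd)))
  rw [lintegral_prod _ hs.aemeasurable]
  refine lintegral_congr fun x => ?_
  refine (lintegral_prod _ (hs.comp measurable_prodMk_left).aemeasurable).trans ?_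
  refine lintegral_congr fun B => ?_
  rw [lintegral_symLebesgue (f := fun C => f (fromBlocks (symMatrix ι x) (Matrix.of B)ᵀ
    (Matrix.of B) C)) (hm.comp (measurable_prodMk_left.comp measurable_prodMk_left))]
  rfl

end SymLebesgue

/-! ### The unnormalized inverse Wishart density -/

section Kernel

variable {ι κ : Type*} [Fintype ι] [DecidableEq ι] [Fintype κ] [DecidableEq κ]

open scoped Classical in
/-- The density of the inverse Wishart distribution `IW(δ, D)` without its normalizing constant. -/
def invWishartKernel (δ : ℝ) (D A : Matrix ι ι ℝ) : ℝ≥0∞ :=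
  if A.PosDef then
    ENNReal.ofReal (A.det ^ (-(δ + 2 * (Fintype.card ι : ℝ)) / 2) *
      Real.exp (-(D * A⁻¹).trace / 2))
  else 0

theorem invWishartKernel_of_posDef (δ : ℝ) (D : Matrix ι ι ℝ) {A : Matrix ι ι ℝ} (hA : A.PosDef) :
    invWishartKernel δ D A =
      ENNReal.ofReal (A.det ^ (-(δ + 2 * (Fintype.card ι : ℝ)) / 2) *
        Real.exp (-(D * A⁻¹).trace / 2)) :=
  if_pos hA

theorem invWishartKernel_of_not_posDef (δ : ℝ) (D : Matrix ι ι ℝ) {A : Matrix ι ι ℝ}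
    (hA : ¬ A.PosDef) : invWishartKernel δ D A = 0 :=
  if_neg hA

theorem invWishartKernel_ne_zero (δ : ℝ) (D : Matrix ι ι ℝ) {A : Matrix ι ι ℝ} (hA : A.PosDef) :
    invWishartKernel δ D A ≠ 0 := by
  rw [invWishartKernel_of_posDef δ D hA, ne_eq, ENNReal.ofReal_eq_zero, not_le]
  have := hA.det_pos
  positivity

theorem invWishartKernel_ne_top (δ : ℝ) (D A : Matrix ι ι ℝ) : invWishartKernel δ D A ≠ ∞ := by
  by_cases hA : A.PosDef
  · rw [invWishartKernel_of_posDef δ D hA]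
    exact ENNReal.ofReal_ne_top
  · rw [invWishartKernel_of_not_posDef δ D hA]
    exact ENNReal.zero_ne_top

theorem Matrix.measurable_det : Measurable fun A : Matrix ι ι ℝ => A.det :=
  Continuous.measurable (by fun_prop)

theorem Matrix.measurable_trace_mul_inv :
    Measurable fun p : Matrix ι ι ℝ × Matrix ι ι ℝ => (p.1 * p.2⁻¹).trace := by
  simp only [Matrix.trace, Matrix.diag_apply, Matrix.mul_apply]
  refine Finset.measurable_sum _ fun i _ => Finset.measurable_sum _ fun j _ => ?_
  exact ((Matrix.measurable_entry i j).comp measurable_fst).mul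
    ((Matrix.measurable_entry j i).comp (Matrix.measurable_inv.comp measurable_snd))

theorem measurable_invWishartKernel_uncurry (δ : ℝ) :
    Measurable fun p : Matrix ι ι ℝ × Matrix ι ι ℝ => invWishartKernel δ p.1 p.2 := by
  have hpow : Measurable fun p : Matrix ι ι ℝ × Matrix ι ι ℝ =>
      p.2.det ^ (-(δ + 2 * (Fintype.card ι : ℝ)) / 2) :=
    (Matrix.measurable_det.comp measurable_snd).pow_const _
  have hexp : Measurable fun p : Matrix ι ι ℝ × Matrix ι ι ℝ =>
      Real.exp (-(p.1 * p.2⁻¹).trace / 2) :=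
    (Matrix.measurable_trace_mul_inv.neg.div_const 2).exp
  have hset : MeasurableSet {p : Matrix ι ι ℝ × Matrix ι ι ℝ | p.2.PosDef} :=
    measurable_snd Matrix.measurableSet_posDef
  classical
  exact Measurable.ite hset (hpow.mul hexp).ennreal_ofReal measurable_const

theorem measurable_invWishartKernel (δ : ℝ) (D : Matrix ι ι ℝ) :
    Measurable (invWishartKernel δ D) :=
  (measurable_invWishartKernel_uncurry δ).comp measurable_prodMk_left

/-- The inverse Wishart density is a multiple of the kernel. -/
theorem exists_ofReal_invWishartDensity_eq (δ : ℝ) (D : Matrix ι ι ℝ) :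
    ∃ c : ℝ≥0∞, ∀ A, ENNReal.ofReal (invWishartDensity δ D A) = c * invWishartKernel δ D A := by
  refine ⟨ENNReal.ofReal (D.det ^ ((δ + (Fintype.card ι : ℝ) - 1) / 2) /
        ((2 : ℝ) ^ ((Fintype.card ι : ℝ) * (δ + (Fintype.card ι : ℝ) - 1) / 2) *
          multiGamma (Fintype.card ι) ((δ + (Fintype.card ι : ℝ) - 1) / 2))), fun A => ?_⟩
  by_cases hA : A.PosDef
  · rw [invWishartKernel_of_posDef δ D hA, invWishartDensity, if_pos hA, mul_assoc,
      ENNReal.ofReal_mul']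
    have := hA.det_pos
    positivity
  · rw [invWishartKernel_of_not_posDef δ D hA, invWishartDensity, if_neg hA]
    simp

end Kernel

/-! ### Congruence transformations -/

section Congruence

variable {ι κ : Type*} [Fintype ι] [DecidableEq ι] [Fintype κ] [DecidableEq κ]

theorem Matrix.card_eq_of_mul_eq_one {L : Matrix κ ι ℝ} {L' : Matrix ι κ ℝ}
    (h1 : L * L' = 1) (h2 : L' * L = 1) : Fintype.card κ = Fintype.card ι := by
  have h := Matrix.trace_mul_comm L L'
  rw [h1, h2, trace_one, trace_one] at h
  exact_mod_cast h

omit [DecidableEq ι] in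
-- A right inverse of `L` makes `x ↦ x ᵥ* L` injective, so the form stays definite.
theorem Matrix.PosDef.mul_mul_transpose_of_mul_eq_one {A : Matrix ι ι ℝ} (hA : A.PosDef)
    {L : Matrix κ ι ℝ} {R : Matrix ι κ ℝ} (h : L * R = 1) : (L * A * Lᵀ).PosDef := by
  have := hA.mul_mul_conjTranspose_same (B := L) fun x y hxy => by
    simpa [h] using congrArg (fun z => z ᵥ* R) hxy
  simpa using this

theorem Matrix.posDef_mul_mul_transpose_iff {A : Matrix ι ι ℝ} {L : Matrix κ ι ℝ}
    {L' : Matrix ι κ ℝ} (h1 : L * L' = 1) (h2 : L' * L = 1) :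
    (L * A * Lᵀ).PosDef ↔ A.PosDef := by
  refine ⟨fun h => ?_, fun h => h.mul_mul_transpose_of_mul_eq_one h1⟩
  have h2' : Lᵀ * L'ᵀ = 1 := by rw [← transpose_mul, h2, transpose_one]
  have := h.mul_mul_transpose_of_mul_eq_one h2
  rwa [Matrix.mul_assoc, Matrix.mul_assoc, h2', Matrix.mul_one, ← Matrix.mul_assoc, h2,
    Matrix.one_mul] at this

/-- The rows and columns of `L` have different index types, so `L` has no determinant of its own;
`(Lᵀ * L).det` stands in for its square. -/
theorem Matrix.det_mul_mul_transpose {A : Matrix ι ι ℝ} {L : Matrix κ ι ℝ}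
    {L' : Matrix ι κ ℝ} (h1 : L * L' = 1) (h2 : L' * L = 1) :
    (L * A * Lᵀ).det = A.det * (Lᵀ * L).det := by
  have : L * A * Lᵀ = L * (A * (Lᵀ * L)) * L' := by
    simp only [Matrix.mul_assoc, h1, Matrix.mul_one]
  rw [this, det_conj_of_mul_eq_one h1 h2, det_mul]

theorem Matrix.inv_mul_mul_transpose {A : Matrix ι ι ℝ} (hA : IsUnit A.det) {L : Matrix κ ι ℝ}
    {L' : Matrix ι κ ℝ} (h1 : L * L' = 1) (h2 : L' * L = 1) :
    (L * A * Lᵀ)⁻¹ = L'ᵀ * A⁻¹ * L' := by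
  have h2' : Lᵀ * L'ᵀ = 1 := by rw [← transpose_mul, h2, transpose_one]
  refine inv_eq_right_inv ?_
  calc L * A * Lᵀ * (L'ᵀ * A⁻¹ * L') = L * A * (Lᵀ * L'ᵀ) * A⁻¹ * L' := by
        simp only [Matrix.mul_assoc]
    _ = 1 := by rw [h2', Matrix.mul_one, Matrix.mul_assoc L A, mul_nonsing_inv A hA,
                  Matrix.mul_one, h1]

/-- The determinant is multiplied by a constant, and cyclicity of the trace moves the transformation
from the inverse onto the scale matrix. -/
theorem invWishartKernel_congruence (δ : ℝ) (D : Matrix ι ι ℝ) (A : Matrix κ κ ℝ)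
    {L : Matrix κ ι ℝ} {L' : Matrix ι κ ℝ} (h1 : L * L' = 1) (h2 : L' * L = 1) :
    invWishartKernel δ D (L' * A * L'ᵀ) =
      ENNReal.ofReal ((L'ᵀ * L').det ^ (-(δ + 2 * (Fintype.card ι : ℝ)) / 2)) *
        invWishartKernel δ (L * D * Lᵀ) A := by
  by_cases hA : A.PosDef
  · rw [invWishartKernel_of_posDef δ D ((posDef_mul_mul_transpose_iff h2 h1).2 hA),
      invWishartKernel_of_posDef δ _ hA, card_eq_of_mul_eq_one h1 h2]
    have hpos : 0 < (L'ᵀ * L').det := by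
      have := (Matrix.PosDef.one (n := ι) (R := ℝ)).mul_mul_transpose_of_mul_eq_one
        (L := L'ᵀ) (R := Lᵀ) (by rw [← transpose_mul, h1, transpose_one])
      simpa using this.det_pos
    rw [← ENNReal.ofReal_mul (by positivity), det_mul_mul_transpose h2 h1,
      Real.mul_rpow hA.det_pos.le hpos.le,
      inv_mul_mul_transpose (isUnit_iff_ne_zero.2 hA.det_pos.ne') h2 h1]
    have htr : (D * (Lᵀ * A⁻¹ * L)).trace = (L * D * Lᵀ * A⁻¹).trace := by
      rw [← Matrix.mul_assoc, trace_mul_comm]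
      simp only [Matrix.mul_assoc]
    rw [htr]
    congr 1
    ring
  · rw [invWishartKernel_of_not_posDef δ D (mt (posDef_mul_mul_transpose_iff h2 h1).1 hA),
      invWishartKernel_of_not_posDef δ _ hA, mul_zero]

theorem exists_lintegral_invWishartKernel_congruence (δ : ℝ) (D : Matrix ι ι ℝ)
    {L : Matrix κ ι ℝ} {L' : Matrix ι κ ℝ} (h1 : L * L' = 1) (h2 : L' * L = 1) :
    ∃ c : ℝ≥0∞, ∀ f : Matrix κ κ ℝ → ℝ≥0∞, Measurable f →
      ∫⁻ A, f (L * A * Lᵀ) * invWishartKernel δ D A ∂symLebesgue ι =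
        c * ∫⁻ A, f A * invWishartKernel δ (L * D * Lᵀ) A ∂symLebesgue κ := by
  obtain ⟨c, hc⟩ := exists_lintegral_symLebesgue_congruence L' L h2 h1
  refine ⟨c * ENNReal.ofReal ((L'ᵀ * L').det ^ (-(δ + 2 * (Fintype.card ι : ℝ)) / 2)),
    fun f hf => ?_⟩
  have h1' : L'ᵀ * Lᵀ = 1 := by rw [← transpose_mul, h1, transpose_one]
  have hcancel (A : Matrix κ κ ℝ) : L * (L' * A * L'ᵀ) * Lᵀ = A := by
    rw [Matrix.mul_assoc, Matrix.mul_assoc, h1', Matrix.mul_one, ← Matrix.mul_assoc, h1,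
      Matrix.one_mul]
  have hm : Measurable fun A : Matrix ι ι ℝ => f (L * A * Lᵀ) * invWishartKernel δ D A :=
    (hf.comp (Continuous.measurable (by fun_prop))).mul (measurable_invWishartKernel δ D)
  rw [hc _ hm, mul_assoc, ← lintegral_const_mul' _ _ ENNReal.ofReal_ne_top]
  congr 1
  refine lintegral_congr fun A => ?_
  rw [hcancel, invWishartKernel_congruence δ D A h1 h2]
  ring

end Congruence

/-! ### The Schur complement substitution -/

section Schur

variable {ι κ : Type*} [Fintype ι] [DecidableEq ι] [Fintype κ] [DecidableEq κ]

theorem lintegral_symLebesgue_add_right {f : Matrix ι ι ℝ → ℝ≥0∞} (hf : Measurable f)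
    {Y : Matrix ι ι ℝ} (hY : Yᵀ = Y) :
    ∫⁻ A, f (A + Y) ∂symLebesgue ι = ∫⁻ A, f A ∂symLebesgue ι := by
  have hm : Measurable fun A : Matrix ι ι ℝ => f (A + Y) :=
    hf.comp (Continuous.measurable (by fun_prop))
  rw [lintegral_symLebesgue hf, lintegral_symLebesgue hm,
    ← lintegral_add_right_eq_self (fun x => f (symMatrix ι x)) (symEntries Y)]
  refine lintegral_congr fun x => ?_
  have : symMatrix ι (x + symEntries Y) = symMatrix ι x + symMatrix ι (symEntries Y) := rfl
  rw [this, symMatrix_symEntries hY]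

omit [DecidableEq κ] in
-- The rows of `B` are transformed separately, each with Jacobian `|A.det|`. This factor must be
-- explicit because `A` is itself an integration variable in the Schur substitution.
theorem lintegral_matrix_mul_right {A : Matrix ι ι ℝ} (hA : A.det ≠ 0)
    {f : Matrix κ ι ℝ → ℝ≥0∞} (hf : Measurable f) :
    ∫⁻ B : κ → ι → ℝ, f (Matrix.of B) =
      ENNReal.ofReal (|A.det| ^ Fintype.card κ) *
        ∫⁻ B : κ → ι → ℝ, f (Matrix.of B * A) := by
  let T : (κ → ι → ℝ) →ₗ[ℝ] (κ → ι → ℝ) :=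
    LinearMap.pi fun k => (Matrix.toLin' Aᵀ).comp (LinearMap.proj k)
  have hT (B : κ → ι → ℝ) : T B = fun k i => (Matrix.of B * A) k i := by
    ext k i
    simp [T, Matrix.mul_apply, Matrix.mulVec, dotProduct, mul_comm]
  have hdet : LinearMap.det T = A.det ^ Fintype.card κ := by
    simp [T, LinearMap.det_pi]
  have hne : LinearMap.det T ≠ 0 := by rw [hdet]; exact pow_ne_zero _ hA
  have : (volume : Measure (κ → ι → ℝ)).IsAddHaarMeasure :=
    Measure.pi.isAddHaarMeasure (fun _ : κ => (volume : Measure (ι → ℝ)))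
  have hmap := Measure.map_linearMap_addHaar_eq_smul_addHaar
    (volume : Measure (κ → ι → ℝ)) hne
  have hfT : ∫⁻ B : κ → ι → ℝ, f (Matrix.of B * A) =
      ENNReal.ofReal |(LinearMap.det T)⁻¹| * ∫⁻ B : κ → ι → ℝ, f (Matrix.of B) := by
    rw [← smul_eq_mul, ← lintegral_smul_measure, ← hmap,
      lintegral_map (f := fun B : κ → ι → ℝ => f (Matrix.of B)) (hf.comp measurable_matrixOf)
        T.continuous_of_finiteDimensional.measurable]
    refine lintegral_congr fun B => ?_
    rw [hT]
    rfl
  rw [hfT, ← mul_assoc, ← ENNReal.ofReal_mul (by positivity), hdet, abs_inv, abs_pow,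
    mul_inv_cancel₀ (pow_ne_zero _ (abs_ne_zero.2 hA)), ENNReal.ofReal_one, one_mul]

theorem Matrix.posDef_fromBlocks_zero_iff {A : Matrix ι ι ℝ} {C : Matrix κ κ ℝ} :
    (fromBlocks A 0 0 C).PosDef ↔ A.PosDef ∧ C.PosDef := by
  constructor
  · intro h
    exact ⟨h.submatrix Sum.inl_injective, h.submatrix Sum.inr_injective⟩
  · rintro ⟨hA, hC⟩
    let := hA.isUnit.invertible
    have h0 := (hA.fromBlocks₁₁ (0 : Matrix ι κ ℝ) C).2 (by simpa using hC.posSemidef)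
    rw [conjTranspose_zero] at h0
    refine h0.posDef_iff_det_ne_zero.2 ?_
    rw [det_fromBlocks_zero₂₁]
    exact mul_ne_zero hA.det_pos.ne' hC.det_pos.ne'

/-- The symmetric block matrix with leading block `A`, regression coefficient `Γ` and Schur
complement `C`. -/
def schurMatrix (A : Matrix ι ι ℝ) (Γ : Matrix κ ι ℝ) (C : Matrix κ κ ℝ) :
    Matrix (ι ⊕ κ) (ι ⊕ κ) ℝ :=
  fromBlocks A (Γ * A)ᵀ (Γ * A) (C + Γ * A * Γᵀ)

/-- Block LDLᵀ factorization; the outer factor is unipotent, so congruence by it preserves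
determinants. -/
theorem schurMatrix_eq {A : Matrix ι ι ℝ} (hA : Aᵀ = A) (Γ : Matrix κ ι ℝ) (C : Matrix κ κ ℝ) :
    schurMatrix A Γ C = fromBlocks 1 0 Γ 1 * fromBlocks A 0 0 C * (fromBlocks 1 0 Γ 1)ᵀ := by
  simp [schurMatrix, fromBlocks_transpose, fromBlocks_multiply, hA, add_comm]

/-- Congruence by the unipotent matrix with corner `-Γ` makes the argument block diagonal and
replaces the coefficient `F` of the scale matrix by `F - Γ`. The determinant then splits, and the
trace sees only the diagonal blocks of the new scale matrix. The Jacobian raises the exponent of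
`A.det` to the one for the index type `ι` alone, while relative to `κ` the exponent of `C.det`
corresponds to the parameter `δ + 2 * card ι`. -/
theorem invWishartKernel_schurMatrix (δ : ℝ) {P A : Matrix ι ι ℝ} (hP : Pᵀ = P) (hA : A.PosDef)
    (F Γ : Matrix κ ι ℝ) (V C : Matrix κ κ ℝ) :
    ENNReal.ofReal (|A.det| ^ Fintype.card κ) *
        invWishartKernel δ (schurMatrix P F V) (schurMatrix A Γ C) =
      invWishartKernel δ P A *
        invWishartKernel (δ + 2 * (Fintype.card ι : ℝ)) (V + (Γ - F) * P * (Γ - F)ᵀ) C := by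
  have hAt : Aᵀ = A := by simpa [Matrix.IsHermitian] using hA.isHermitian
  have h1 : (fromBlocks 1 0 Γ 1 : Matrix (ι ⊕ κ) (ι ⊕ κ) ℝ) * fromBlocks 1 0 (-Γ) 1 = 1 := by
    simp [fromBlocks_multiply]
  have h2 : (fromBlocks 1 0 (-Γ) 1 : Matrix (ι ⊕ κ) (ι ⊕ κ) ℝ) * fromBlocks 1 0 Γ 1 = 1 := by
    simp [fromBlocks_multiply]
  have hT : ((fromBlocks 1 0 Γ 1 : Matrix (ι ⊕ κ) (ι ⊕ κ) ℝ)ᵀ * fromBlocks 1 0 Γ 1).det = 1 := by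
    simp
  have hD : fromBlocks 1 0 (-Γ) 1 * schurMatrix P F V * (fromBlocks 1 0 (-Γ) 1)ᵀ =
      fromBlocks P ((F - Γ) * P)ᵀ ((F - Γ) * P) (V + (Γ - F) * P * (Γ - F)ᵀ) := by
    simp only [schurMatrix, fromBlocks_transpose, fromBlocks_multiply]
    congr 1 <;> simp [hP, Matrix.mul_add, Matrix.add_mul, Matrix.mul_sub, Matrix.sub_mul,
      Matrix.mul_assoc] <;> abel
  rw [schurMatrix_eq hAt, invWishartKernel_congruence δ _ _ h2 h1, hT, hD, Real.one_rpow,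
    ENNReal.ofReal_one, one_mul]
  by_cases hC : C.PosDef
  · have hb : (fromBlocks A 0 0 C).PosDef := posDef_fromBlocks_zero_iff.2 ⟨hA, hC⟩
    have hinv : (fromBlocks A 0 0 C)⁻¹ = fromBlocks A⁻¹ 0 0 C⁻¹ := by
      refine inv_eq_right_inv ?_
      simp [fromBlocks_multiply, mul_nonsing_inv _ (isUnit_iff_ne_zero.2 hA.det_pos.ne'),
        mul_nonsing_inv _ (isUnit_iff_ne_zero.2 hC.det_pos.ne')]
    rw [invWishartKernel_of_posDef _ _ hb, invWishartKernel_of_posDef _ _ hA,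
      invWishartKernel_of_posDef _ _ hC, hinv, det_fromBlocks_zero₂₁,
      ← ENNReal.ofReal_mul (by positivity),
      ← ENNReal.ofReal_mul (by have := hA.det_pos; positivity)]
    congr 1
    have htr : (fromBlocks P ((F - Γ) * P)ᵀ ((F - Γ) * P) (V + (Γ - F) * P * (Γ - F)ᵀ) *
        fromBlocks A⁻¹ 0 0 C⁻¹).trace =
        (P * A⁻¹).trace + ((V + (Γ - F) * P * (Γ - F)ᵀ) * C⁻¹).trace := by
      simp [fromBlocks_multiply, trace, Fintype.sum_sum_type]
    have hsplit (x y : ℝ) : Real.exp (-(x + y) / 2) = Real.exp (-x / 2) * Real.exp (-y / 2) := by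
      rw [← Real.exp_add]
      congr 1
      ring
    rw [htr, hsplit, abs_of_pos hA.det_pos,
      Real.mul_rpow hA.det_pos.le hC.det_pos.le, Fintype.card_sum, ← Real.rpow_natCast]
    have hexp : A.det ^ (-(δ + 2 * (Fintype.card ι : ℝ)) / 2) =
        A.det ^ (Fintype.card κ : ℝ) *
          A.det ^ (-(δ + 2 * ((Fintype.card ι + Fintype.card κ : ℕ) : ℝ)) / 2) := by
      rw [← Real.rpow_add hA.det_pos]
      congr 1
      push_cast
      ring
    have hexp' : -(δ + 2 * ((Fintype.card ι + Fintype.card κ : ℕ) : ℝ)) / 2 =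
        -(δ + 2 * (Fintype.card ι : ℝ) + 2 * (Fintype.card κ : ℝ)) / 2 := by
      push_cast
      ring
    rw [hexp, hexp']
    ring
  · rw [invWishartKernel_of_not_posDef _ _ (mt (fun h => (posDef_fromBlocks_zero_iff.1 h).2) hC),
      invWishartKernel_of_not_posDef _ _ hC, mul_zero, mul_zero]

/-- The substitution `(A, B, C) ↦ (A, B A⁻¹, C - B A⁻¹ Bᵀ)` in integrals against the inverse
Wishart kernel: the leading block is independent of the regression coefficient and the Schur
complement. -/
theorem exists_lintegral_invWishartKernel_schurMatrix (δ : ℝ) {P : Matrix ι ι ℝ} (hP : Pᵀ = P)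
    (F : Matrix κ ι ℝ) (V : Matrix κ κ ℝ) :
    ∃ c : ℝ≥0∞, ∀ f : Matrix (ι ⊕ κ) (ι ⊕ κ) ℝ → ℝ≥0∞, Measurable f →
      ∫⁻ M, f M * invWishartKernel δ (schurMatrix P F V) M ∂symLebesgue (ι ⊕ κ) =
        c * ∫⁻ A, invWishartKernel δ P A * (∫⁻ Γ : κ → ι → ℝ,
          (∫⁻ C, f (schurMatrix A (Matrix.of Γ) C) *
            invWishartKernel (δ + 2 * (Fintype.card ι : ℝ))
              (V + (Matrix.of Γ - F) * P * (Matrix.of Γ - F)ᵀ) C ∂symLebesgue κ))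
          ∂symLebesgue ι := by
  obtain ⟨c, hc⟩ := exists_lintegral_symLebesgue_sum ι κ
  refine ⟨c, fun f hf => ?_⟩
  set k := invWishartKernel δ (schurMatrix P F V) with hk
  have hkm : Measurable k := measurable_invWishartKernel δ _
  rw [hc (fun M => f M * k M) (hf.mul hkm)]
  congr 1
  refine lintegral_congr fun A => ?_
  by_cases hA : A.PosDef
  swap
  · rw [invWishartKernel_of_not_posDef _ _ hA, zero_mul]
    have h0 (B : κ → ι → ℝ) (C : Matrix κ κ ℝ) :
        k (fromBlocks A (Matrix.of B)ᵀ (Matrix.of B) C) = 0 :=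
      invWishartKernel_of_not_posDef _ _ fun h => hA (h.submatrix Sum.inl_injective)
    simp [h0]
  have hAt : Aᵀ = A := by simpa [Matrix.IsHermitian] using hA.isHermitian
  have hm : Measurable fun p : Matrix κ ι ℝ × Matrix κ κ ℝ =>
      f (fromBlocks A p.1ᵀ p.1 p.2) * k (fromBlocks A p.1ᵀ p.1 p.2) :=
    (hf.mul hkm).comp (measurable_fromBlocks_symm measurable_const measurable_fst measurable_snd)
  -- At fixed `A`, substitute `B = Γ A`.
  refine (lintegral_matrix_mul_right hA.det_pos.ne' (f := fun B => ∫⁻ C,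
      f (fromBlocks A Bᵀ B C) * k (fromBlocks A Bᵀ B C) ∂symLebesgue κ)
      hm.lintegral_prod_right').trans ?_
  rw [← lintegral_const_mul' _ _ ENNReal.ofReal_ne_top,
    ← lintegral_const_mul' _ _ (invWishartKernel_ne_top _ _ _)]
  refine lintegral_congr fun Γ => ?_
  have hY : (Matrix.of Γ * A * (Matrix.of Γ)ᵀ)ᵀ = Matrix.of Γ * A * (Matrix.of Γ)ᵀ := by
    simp [transpose_mul, hAt, Matrix.mul_assoc]
  have hmC : Measurable fun C : Matrix κ κ ℝ =>
      f (fromBlocks A (Matrix.of Γ * A)ᵀ (Matrix.of Γ * A) C) *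
        k (fromBlocks A (Matrix.of Γ * A)ᵀ (Matrix.of Γ * A) C) :=
    hm.comp measurable_prodMk_left
  -- At fixed `A` and `Γ`, translate the lower right block by `Γ A Γᵀ`, which leaves the Schur
  -- complement as variable.
  rw [← lintegral_symLebesgue_add_right hmC hY,
    ← lintegral_const_mul' _ _ ENNReal.ofReal_ne_top,
    ← lintegral_const_mul' _ _ (invWishartKernel_ne_top _ _ _)]
  refine lintegral_congr fun C => ?_
  have := invWishartKernel_schurMatrix δ hP hA F (Matrix.of Γ) V C
  rw [← hk] at this
  simp only [schurMatrix] at this ⊢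
  rw [mul_left_comm, this, mul_left_comm]

end Schur

/-! ### Linear images of inverse Wishart matrices -/

section Compression

variable {ι κ α : Type*} [Fintype ι] [DecidableEq ι] [Fintype κ] [DecidableEq κ]
  [Fintype α] [DecidableEq α]

/-- Every positive definite `D` is a `schurMatrix`, and after the Schur substitution the integral
over `(Γ, C)` is a number `K` independent of `A`. It is absorbed into the constant, with no need to
check that it is finite. -/
theorem exists_lintegral_invWishartKernel_toBlocks₁₁ (δ : ℝ) {D : Matrix (ι ⊕ κ) (ι ⊕ κ) ℝ}
    (hD : D.PosDef) :
    ∃ c : ℝ≥0∞, ∀ f : Matrix ι ι ℝ → ℝ≥0∞, Measurable f →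
      ∫⁻ M, f M.toBlocks₁₁ * invWishartKernel δ D M ∂symLebesgue (ι ⊕ κ) =
        c * ∫⁻ A, f A * invWishartKernel δ D.toBlocks₁₁ A ∂symLebesgue ι := by
  have hP : D.toBlocks₁₁.PosDef := hD.submatrix Sum.inl_injective
  have hDt : Dᵀ = D := by simpa [Matrix.IsHermitian] using hD.isHermitian
  set P := D.toBlocks₁₁ with hPdef
  set F := D.toBlocks₂₁ * P⁻¹ with hF
  have hPt : Pᵀ = P := by simpa [Matrix.IsHermitian] using hP.isHermitian
  have hFP : F * P = D.toBlocks₂₁ := by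
    rw [hF, Matrix.mul_assoc, nonsing_inv_mul _ (isUnit_iff_ne_zero.2 hP.det_pos.ne'),
      Matrix.mul_one]
  set V := D.toBlocks₂₂ - F * P * Fᵀ with hV
  have hDe : D = schurMatrix P F V := by
    have h12 : D.toBlocks₂₁ᵀ = D.toBlocks₁₂ := by
      ext i j
      exact congrFun (congrFun hDt (Sum.inl i)) (Sum.inr j)
    rw [schurMatrix, hV, sub_add_cancel, hFP, h12, hPdef, fromBlocks_toBlocks]
  obtain ⟨c, hc⟩ := exists_lintegral_invWishartKernel_schurMatrix δ hPt F V
  rw [← hDe] at hc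
  let h : Matrix κ ι ℝ → Matrix κ κ ℝ → ℝ≥0∞ := fun Γ =>
    invWishartKernel (δ + 2 * (Fintype.card ι : ℝ)) (V + (Γ - F) * P * (Γ - F)ᵀ)
  have hh : Measurable fun p : Matrix κ ι ℝ × Matrix κ κ ℝ => h p.1 p.2 :=
    (measurable_invWishartKernel_uncurry _).comp
      (Measurable.prodMk (Continuous.measurable (by fun_prop)) measurable_snd)
  let K := ∫⁻ Γ : κ → ι → ℝ, (∫⁻ C, h (Matrix.of Γ) C ∂symLebesgue κ)
  refine ⟨c * K, fun f hf => ?_⟩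
  have hm1 : Measurable fun M : Matrix (ι ⊕ κ) (ι ⊕ κ) ℝ => f M.toBlocks₁₁ :=
    hf.comp (Matrix.measurable_of_entries fun i j => Matrix.measurable_entry _ _)
  rw [hc _ hm1, mul_assoc, ← lintegral_const_mul _ (f := fun A => f A * invWishartKernel δ P A)
    (hf.mul (measurable_invWishartKernel δ P))]
  congr 1
  refine lintegral_congr fun A => ?_
  have hinner : ∫⁻ Γ : κ → ι → ℝ, (∫⁻ C, f (schurMatrix A (Matrix.of Γ) C).toBlocks₁₁ *
      h (Matrix.of Γ) C ∂symLebesgue κ) = f A * K := by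
    have hK : Measurable fun Γ : κ → ι → ℝ => ∫⁻ C, h (Matrix.of Γ) C ∂symLebesgue κ :=
      hh.lintegral_prod_right'.comp measurable_matrixOf
    rw [← lintegral_const_mul _ hK]
    refine lintegral_congr fun Γ => ?_
    have hΓ : Measurable fun C => h (Matrix.of Γ) C := measurable_invWishartKernel _ _
    rw [← lintegral_const_mul _ hΓ]
    rfl
  rw [hinner]
  ring

/-- A matrix with a right inverse can be completed to an invertible matrix. -/
theorem Matrix.exists_fromRows_mul_fromCols_eq_one {L : Matrix α ι ℝ} {R : Matrix ι α ℝ}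
    (h : L * R = 1) :
    ∃ (k : ℕ) (L₂ : Matrix (Fin k) ι ℝ) (B : Matrix ι (Fin k) ℝ),
      fromRows L L₂ * fromCols R B = 1 ∧ fromCols R B * fromRows L L₂ = 1 := by
  -- The extra columns `B` are a basis of the kernel of `L`; the extra rows `L₂` are the
  -- coordinates, in that basis, of the projection `1 - R * L` onto the kernel.
  let K := LinearMap.ker L.toLin'
  let b := Module.finBasis ℝ K
  have hpr (x : ι → ℝ) :
      (LinearMap.id - R.toLin' ∘ₗ L.toLin' : (ι → ℝ) →ₗ[ℝ] ι → ℝ) x ∈ K := by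
    simp [K, mulVec_sub, ← Matrix.mul_assoc, h]
  let pr : (ι → ℝ) →ₗ[ℝ] K := LinearMap.codRestrict K (LinearMap.id - R.toLin' ∘ₗ L.toLin') hpr
  have hsub : K.subtype ∘ₗ pr = LinearMap.id - R.toLin' ∘ₗ L.toLin' := rfl
  have hprK : pr ∘ₗ K.subtype = LinearMap.id := by
    ext x : 1
    apply Subtype.ext
    simp [pr]
  have hprR : pr ∘ₗ R.toLin' = 0 := by
    refine LinearMap.ext fun x => Subtype.ext ?_
    simp [pr, h]
  have hLK : L.toLin' ∘ₗ K.subtype = 0 := by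
    exact LinearMap.ext fun x => LinearMap.mem_ker.1 x.2
  let L₂ := LinearMap.toMatrix' (b.equivFun.toLinearMap ∘ₗ pr)
  let B := LinearMap.toMatrix' (K.subtype ∘ₗ b.equivFun.symm.toLinearMap)
  have hLB : L * B = 0 := by
    conv_lhs => rw [← LinearMap.toMatrix'_toLin' L]
    rw [← LinearMap.toMatrix'_comp, ← LinearMap.comp_assoc, hLK]
    simp
  have hLR : L₂ * R = 0 := by
    conv_lhs => rw [← LinearMap.toMatrix'_toLin' R]
    rw [← LinearMap.toMatrix'_comp, LinearMap.comp_assoc, hprR]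
    simp
  have hLB₂ : L₂ * B = 1 := by
    rw [← LinearMap.toMatrix'_comp, LinearMap.comp_assoc, ← LinearMap.comp_assoc _ K.subtype,
      hprK, LinearMap.id_comp, LinearEquiv.comp_symm, LinearMap.toMatrix'_id]
  have hBL : B * L₂ = 1 - R * L := by
    rw [← LinearMap.toMatrix'_comp, LinearMap.comp_assoc,
      ← LinearMap.comp_assoc _ b.equivFun.toLinearMap, LinearEquiv.symm_comp, LinearMap.id_comp,
      hsub, map_sub, LinearMap.toMatrix'_id, LinearMap.toMatrix'_comp,
      LinearMap.toMatrix'_toLin', LinearMap.toMatrix'_toLin']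
  refine ⟨_, L₂, B, ?_, ?_⟩
  · rw [fromRows_mul_fromCols, h, hLB, hLR, hLB₂, fromBlocks_one]
  · rw [fromCols_mul_fromRows, hBL, add_sub_cancel]

/-- If `M` has an inverse Wishart distribution with parameters `δ, D` and `L` has full row rank,
then `L M Lᵀ` has an inverse Wishart distribution with parameters `δ, L D Lᵀ`. -/
theorem exists_lintegral_invWishartKernel_compression (δ : ℝ) {D : Matrix ι ι ℝ} (hD : D.PosDef)
    {L : Matrix α ι ℝ} {R : Matrix ι α ℝ} (h : L * R = 1) :
    ∃ c : ℝ≥0∞, ∀ f : Matrix α α ℝ → ℝ≥0∞, Measurable f →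
      ∫⁻ M, f (L * M * Lᵀ) * invWishartKernel δ D M ∂symLebesgue ι =
        c * ∫⁻ A, f A * invWishartKernel δ (L * D * Lᵀ) A ∂symLebesgue α := by
  -- Complete `L` to an invertible matrix, apply the invertible congruence, then marginalize to the
  -- leading block.
  obtain ⟨k, L₂, B, h1, h2⟩ := Matrix.exists_fromRows_mul_fromCols_eq_one h
  have hblock (M : Matrix ι ι ℝ) :
      (fromRows L L₂ * M * (fromRows L L₂)ᵀ).toBlocks₁₁ = L * M * Lᵀ := by
    rw [fromRows_mul, transpose_fromRows, fromRows_mul_fromCols, toBlocks_fromBlocks₁₁]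
  obtain ⟨c₁, hc₁⟩ := exists_lintegral_invWishartKernel_congruence δ D h1 h2
  obtain ⟨c₂, hc₂⟩ := exists_lintegral_invWishartKernel_toBlocks₁₁ δ
    (hD.mul_mul_transpose_of_mul_eq_one h1)
  rw [hblock] at hc₂
  refine ⟨c₁ * c₂, fun f hf => ?_⟩
  have hm1 : Measurable fun M : Matrix (α ⊕ Fin k) (α ⊕ Fin k) ℝ => f M.toBlocks₁₁ :=
    hf.comp (Matrix.measurable_of_entries fun i j => Matrix.measurable_entry _ _)
  rw [mul_assoc, ← hc₂ f hf, ← hc₁ _ hm1]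
  simp only [hblock]

end Compression

/-! ### The inverse gamma integral -/

section InverseGamma

/-- The Gamma integrand after `x ↦ x⁻¹`, arranged for `integral_comp_rpow_Ioi`. -/
theorem inverseGamma_eq_comp_rpow (s r : ℝ) {x : ℝ} (hx : 0 < x) :
    x ^ ((-1 : ℝ) - 1) • ((x ^ (-1 : ℝ)) ^ (s - 1) * Real.exp (-(r * x ^ (-1 : ℝ)))) =
      x ^ (-s - 1) * Real.exp (-(r / x)) := by
  rw [smul_eq_mul, ← mul_assoc, ← Real.rpow_mul hx.le, ← Real.rpow_add hx, Real.rpow_neg_one,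
    div_eq_mul_inv]
  congr 2
  ring

theorem integral_inverseGamma {s r : ℝ} (hs : 0 < s) (hr : 0 < r) :
    ∫ x in Set.Ioi (0 : ℝ), x ^ (-s - 1) * Real.exp (-(r / x)) = (1 / r) ^ s * Real.Gamma s := by
  rw [← Real.integral_rpow_mul_exp_neg_mul_Ioi hs hr,
    ← integral_comp_rpow_Ioi (fun y : ℝ => y ^ (s - 1) * Real.exp (-(r * y)))
      (neg_ne_zero.2 (one_ne_zero (α := ℝ)))]
  refine setIntegral_congr_fun measurableSet_Ioi fun x hx => ?_
  rw [← inverseGamma_eq_comp_rpow s r hx]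
  simp

theorem integral_inverseGamma_pos {s r : ℝ} (hs : 0 < s) (hr : 0 < r) :
    0 < ∫ x in Set.Ioi (0 : ℝ), x ^ (-s - 1) * Real.exp (-(r / x)) := by
  rw [integral_inverseGamma hs hr]
  have := Real.Gamma_pos_of_pos hs
  positivity

/-- The Bochner integral of a non-integrable function is zero by convention, so a positive value
already forces integrability. -/
theorem integrableOn_inverseGamma {s r : ℝ} (hs : 0 < s) (hr : 0 < r) :
    IntegrableOn (fun x => x ^ (-s - 1) * Real.exp (-(r / x))) (Set.Ioi 0) := by
  by_contra h
  exact (integral_inverseGamma_pos hs hr).ne' (integral_undef h)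

/-- Lowering `s` by one multiplies the integrand by `x`, so this is the inverse gamma mean; it comes
from the functional equation of `Γ`. -/
theorem integral_inverseGamma_sub_one {s r : ℝ} (hs : 1 < s) (hr : 0 < r) :
    ∫ x in Set.Ioi (0 : ℝ), x ^ (-(s - 1) - 1) * Real.exp (-(r / x)) =
      r / (s - 1) * ∫ x in Set.Ioi (0 : ℝ), x ^ (-s - 1) * Real.exp (-(r / x)) := by
  have hs1 : 0 < s - 1 := by linarith
  rw [integral_inverseGamma hs1 hr, integral_inverseGamma (by linarith) hr]
  have hG : Real.Gamma s = (s - 1) * Real.Gamma (s - 1) := by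
    conv_lhs => rw [← sub_add_cancel s 1]
    exact Real.Gamma_add_one hs1.ne'
  have hp : (1 / r) ^ s = (1 / r) ^ (s - 1) * (1 / r) := by
    rw [← Real.rpow_add_one (by positivity)]
    simp
  rw [hG, hp]
  field_simp

/-- The mean of the inverse gamma distribution, in unnormalized form. -/
theorem lintegral_affine_mul_inverseGamma {s r a b : ℝ} (hs : 1 < s) (hr : 0 < r) (ha : 0 ≤ a)
    (hb : 0 ≤ b) :
    ∫⁻ x in Set.Ioi (0 : ℝ), ENNReal.ofReal (a + b * x) *
        ENNReal.ofReal (x ^ (-s - 1) * Real.exp (-(r / x))) =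
      ENNReal.ofReal (a + b * (r / (s - 1))) *
        ∫⁻ x in Set.Ioi (0 : ℝ), ENNReal.ofReal (x ^ (-s - 1) * Real.exp (-(r / x))) := by
  have hs1 : 0 < s - 1 := by linarith
  have hi := integrableOn_inverseGamma (by linarith : 0 < s) hr
  have hi' := integrableOn_inverseGamma hs1 hr
  have hpos : ∀ᵐ x ∂(volume.restrict (Set.Ioi (0 : ℝ))),
      0 ≤ x ^ (-s - 1) * Real.exp (-(r / x)) := by
    filter_upwards [ae_restrict_mem measurableSet_Ioi] with x hx
    have : (0 : ℝ) < x := hx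
    positivity
  have hxw (x : ℝ) (hx : x ∈ Set.Ioi (0 : ℝ)) :
      (a + b * x) * (x ^ (-s - 1) * Real.exp (-(r / x))) =
        a * (x ^ (-s - 1) * Real.exp (-(r / x))) +
          b * (x ^ (-(s - 1) - 1) * Real.exp (-(r / x))) := by
    have hx0 : (0 : ℝ) < x := hx
    have : x ^ (-(s - 1) - 1) = x * x ^ (-s - 1) := by
      rw [mul_comm, ← Real.rpow_add_one hx0.ne']
      congr 1
      ring
    rw [this]
    ring
  have hi2 : IntegrableOn (fun x => (a + b * x) * (x ^ (-s - 1) * Real.exp (-(r / x))))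
      (Set.Ioi 0) :=
    IntegrableOn.congr_fun (f := fun x => a * (x ^ (-s - 1) * Real.exp (-(r / x))) +
      b * (x ^ (-(s - 1) - 1) * Real.exp (-(r / x))))
      ((hi.const_mul a).add (hi'.const_mul b)) (fun x hx => (hxw x hx).symm) measurableSet_Ioi
  rw [← ofReal_integral_eq_lintegral_ofReal hi hpos, ← ENNReal.ofReal_mul (by positivity)]
  have hlhs : ∫⁻ x in Set.Ioi (0 : ℝ), ENNReal.ofReal (a + b * x) *
      ENNReal.ofReal (x ^ (-s - 1) * Real.exp (-(r / x))) =
      ∫⁻ x in Set.Ioi (0 : ℝ),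
        ENNReal.ofReal ((a + b * x) * (x ^ (-s - 1) * Real.exp (-(r / x)))) := by
    refine setLIntegral_congr_fun measurableSet_Ioi fun x hx => ?_
    have : (0 : ℝ) < x := hx
    exact (ENNReal.ofReal_mul (by positivity)).symm
  rw [hlhs, ← ofReal_integral_eq_lintegral_ofReal hi2]
  · rw [setIntegral_congr_fun measurableSet_Ioi hxw,
      integral_add (hi.const_mul a) (hi'.const_mul b), integral_const_mul, integral_const_mul,
      integral_inverseGamma_sub_one hs hr]
    congr 1
    ring
  · filter_upwards [hpos, ae_restrict_mem measurableSet_Ioi] with x hx hx'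
    have : (0 : ℝ) < x := hx'
    positivity

end InverseGamma

/-! ### Gaussian integrals of quadratic functions -/

section Gaussian

theorem integral_mul_exp_neg_sq_div_two : ∫ x : ℝ, x * Real.exp (-x ^ 2 / 2) = 0 := by
  have h := integral_neg_eq_self (fun x : ℝ => x * Real.exp (-x ^ 2 / 2)) volume
  simp only [neg_sq, neg_mul, integral_neg] at h
  linarith

/-- The unit variance of the standard Gaussian, with the normalizing constant cancelled. -/
theorem integral_sq_mul_exp_neg_sq_div_two :
    ∫ x : ℝ, x ^ 2 * Real.exp (-x ^ 2 / 2) = ∫ x : ℝ, Real.exp (-x ^ 2 / 2) := by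
  have h1 : ∫ x, x ^ 2 ∂gaussianReal 0 1 = 1 := by
    have := variance_fun_id_gaussianReal (μ := 0) (v := 1)
    rw [variance_eq_integral aemeasurable_id'] at this
    simpa using this
  have h2 := integral_gaussianPDFReal_eq_one 0 (one_ne_zero (α := ℝ≥0))
  rw [integral_gaussianReal_eq_integral_smul one_ne_zero] at h1
  rw [← h2] at h1
  simp only [gaussianPDFReal, sub_zero, NNReal.coe_one, mul_one, smul_eq_mul, mul_assoc,
    integral_const_mul] at h1
  have hne : (√(2 * Real.pi))⁻¹ ≠ 0 := by positivity
  have h3 := mul_left_cancel₀ hne h1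
  rw [← h3]
  exact integral_congr_ae (.of_forall fun x => mul_comm _ _)

theorem integral_exp_neg_sq_div_two_pos : 0 < ∫ x : ℝ, Real.exp (-x ^ 2 / 2) := by
  have := integral_gaussian (1 / 2)
  have h : ∫ x : ℝ, Real.exp (-x ^ 2 / 2) = ∫ x : ℝ, Real.exp (-(1 / 2) * x ^ 2) :=
    integral_congr_ae (.of_forall fun x => by ring_nf)
  rw [h, this]
  positivity

theorem integrable_exp_neg_sq_div_two : Integrable fun x : ℝ => Real.exp (-x ^ 2 / 2) := by
  refine (integrable_exp_neg_mul_sq (b := 1 / 2) (by norm_num)).congr (.of_forall fun x => ?_)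
  ring_nf

theorem integrable_mul_exp_neg_sq_div_two :
    Integrable fun x : ℝ => x * Real.exp (-x ^ 2 / 2) := by
  refine (integrable_mul_exp_neg_mul_sq (b := 1 / 2) (by norm_num)).congr (.of_forall fun x => ?_)
  ring_nf

theorem integrable_sq_mul_exp_neg_sq_div_two :
    Integrable fun x : ℝ => x ^ 2 * Real.exp (-x ^ 2 / 2) := by
  by_contra h
  have := integral_sq_mul_exp_neg_sq_div_two
  rw [integral_undef h] at this
  exact integral_exp_neg_sq_div_two_pos.ne this

variable {ι : Type*} [Fintype ι]

theorem exp_neg_dotProduct_self_div_two (x : ι → ℝ) :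
    Real.exp (-(x ⬝ᵥ x) / 2) = ∏ i, Real.exp (-x i ^ 2 / 2) := by
  rw [← Real.exp_sum, dotProduct, ← Finset.sum_div, ← Finset.sum_neg_distrib]
  simp only [sq]

theorem integral_exp_neg_dotProduct_self_div_two :
    ∫ x : ι → ℝ, Real.exp (-(x ⬝ᵥ x) / 2) =
      (∫ x : ℝ, Real.exp (-x ^ 2 / 2)) ^ Fintype.card ι := by
  simp only [exp_neg_dotProduct_self_div_two]
  exact integral_fintype_prod_volume_eq_pow fun x : ℝ => Real.exp (-x ^ 2 / 2)

theorem integrable_exp_neg_dotProduct_self_div_two :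
    Integrable fun x : ι → ℝ => Real.exp (-(x ⬝ᵥ x) / 2) := by
  simp only [exp_neg_dotProduct_self_div_two]
  exact Integrable.fintype_prod (f := fun (_ : ι) (x : ℝ) => Real.exp (-x ^ 2 / 2))
    fun _ => integrable_exp_neg_sq_div_two

variable [DecidableEq ι]

/-- A monomial times the Gaussian weight is a product of functions of one coordinate each, and a
factor of first order integrates to zero. -/
theorem integrable_and_integral_coord_mul_gaussian (i : ι) :
    Integrable (fun x : ι → ℝ => x i * Real.exp (-(x ⬝ᵥ x) / 2)) ∧
      ∫ x : ι → ℝ, x i * Real.exp (-(x ⬝ᵥ x) / 2) = 0 := by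
  let f : ι → ℝ → ℝ := fun k x => (if k = i then x else 1) * Real.exp (-x ^ 2 / 2)
  have hf (x : ι → ℝ) : x i * Real.exp (-(x ⬝ᵥ x) / 2) = ∏ k, f k (x k) := by
    simp only [f, exp_neg_dotProduct_self_div_two, Finset.prod_mul_distrib, Finset.prod_ite_eq',
      Finset.mem_univ, if_true]
  have hfi (k : ι) : Integrable (f k) := by
    by_cases hk : k = i
    · simpa [f, hk] using integrable_mul_exp_neg_sq_div_two
    · simpa [f, hk] using integrable_exp_neg_sq_div_two
  simp only [hf]
  refine ⟨Integrable.fintype_prod hfi, ?_⟩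
  refine (integral_fintype_prod_volume_eq_prod f).trans (Finset.prod_eq_zero (Finset.mem_univ i) ?_)
  simpa [f] using integral_mul_exp_neg_sq_div_two

theorem integrable_and_integral_coord_mul_coord_mul_gaussian (i j : ι) :
    Integrable (fun x : ι → ℝ => x i * x j * Real.exp (-(x ⬝ᵥ x) / 2)) ∧
      ∫ x : ι → ℝ, x i * x j * Real.exp (-(x ⬝ᵥ x) / 2) =
        if i = j then ∫ x : ι → ℝ, Real.exp (-(x ⬝ᵥ x) / 2) else 0 := by
  let f : ι → ℝ → ℝ := fun k x =>
    (if k = i then x else 1) * (if k = j then x else 1) * Real.exp (-x ^ 2 / 2)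
  have hf (x : ι → ℝ) : x i * x j * Real.exp (-(x ⬝ᵥ x) / 2) = ∏ k, f k (x k) := by
    simp only [f, exp_neg_dotProduct_self_div_two, Finset.prod_mul_distrib, Finset.prod_ite_eq',
      Finset.mem_univ, if_true]
  have hfi (k : ι) : Integrable (f k) := by
    by_cases hk : k = i <;> by_cases hk' : k = j
    · simpa [f, ← hk, ← hk', ← sq] using integrable_sq_mul_exp_neg_sq_div_two
    · simpa [f, ← hk, hk'] using integrable_mul_exp_neg_sq_div_two
    · simpa [f, hk, ← hk'] using integrable_mul_exp_neg_sq_div_two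
    · simpa [f, hk, hk'] using integrable_exp_neg_sq_div_two
  simp only [hf]
  refine ⟨Integrable.fintype_prod hfi, (integral_fintype_prod_volume_eq_prod f).trans ?_⟩
  split_ifs with hij
  · rw [integral_exp_neg_dotProduct_self_div_two, ← Finset.card_univ, ← Finset.prod_const]
    refine Finset.prod_congr rfl fun k _ => ?_
    by_cases hk : k = i
    · simpa [f, ← hij, hk, ← sq] using integral_sq_mul_exp_neg_sq_div_two
    · simp [f, ← hij, hk]
  · refine Finset.prod_eq_zero (Finset.mem_univ i) ?_
    simpa [f, hij] using integral_mul_exp_neg_sq_div_two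

/-- The mean of a nonnegative quadratic polynomial under the standard Gaussian distribution, in
unnormalized form. -/
theorem lintegral_quadratic_mul_gaussian {a : ℝ} {l : ι → ℝ} {Q : Matrix ι ι ℝ}
    (h : ∀ x, 0 ≤ a + l ⬝ᵥ x + x ⬝ᵥ (Q *ᵥ x)) :
    ∫⁻ x : ι → ℝ, ENNReal.ofReal (a + l ⬝ᵥ x + x ⬝ᵥ (Q *ᵥ x)) *
        ENNReal.ofReal (Real.exp (-(x ⬝ᵥ x) / 2)) =
      ENNReal.ofReal (a + Q.trace) * ∫⁻ x : ι → ℝ, ENNReal.ofReal (Real.exp (-(x ⬝ᵥ x) / 2)) := by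
  let e : (ι → ℝ) → ℝ := fun x => Real.exp (-(x ⬝ᵥ x) / 2)
  have he : Integrable e := integrable_exp_neg_dotProduct_self_div_two
  have hexp (x : ι → ℝ) : (a + l ⬝ᵥ x + x ⬝ᵥ (Q *ᵥ x)) * e x =
      a * e x + (∑ i, l i * (x i * e x)) + ∑ i, ∑ j, Q i j * (x i * x j * e x) := by
    simp only [dotProduct, mulVec, add_mul, Finset.sum_mul, Finset.mul_sum]
    congr 1
    · congr 1
      exact Finset.sum_congr rfl fun i _ => by ring
    · exact Finset.sum_congr rfl fun i _ => Finset.sum_congr rfl fun j _ => by ring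
  have h1 (i : ι) : Integrable fun x : ι → ℝ => l i * (x i * e x) :=
    (integrable_and_integral_coord_mul_gaussian i).1.const_mul _
  have h2 (i j : ι) : Integrable fun x : ι → ℝ => Q i j * (x i * x j * e x) :=
    (integrable_and_integral_coord_mul_coord_mul_gaussian i j).1.const_mul _
  have hs1 : Integrable fun x : ι → ℝ => ∑ i, l i * (x i * e x) :=
    integrable_finsetSum _ fun i _ => h1 i
  have hs2 : Integrable fun x : ι → ℝ => ∑ i, ∑ j, Q i j * (x i * x j * e x) :=
    integrable_finsetSum _ fun i _ => integrable_finsetSum _ fun j _ => h2 i j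
  have hint : ∫ x, (a + l ⬝ᵥ x + x ⬝ᵥ (Q *ᵥ x)) * e x = (a + Q.trace) * ∫ x, e x := by
    simp only [hexp]
    have hadd : ∫ x, a * e x + (∑ i, l i * (x i * e x)) + ∑ i, ∑ j, Q i j * (x i * x j * e x) =
        (∫ x, a * e x) + (∫ x : ι → ℝ, ∑ i, l i * (x i * e x)) +
          ∫ x : ι → ℝ, ∑ i, ∑ j, Q i j * (x i * x j * e x) := by
      rw [← integral_add (he.const_mul a) hs1]
      exact integral_add ((he.const_mul a).add hs1) hs2
    rw [hadd, integral_const_mul, integral_finsetSum _ fun i _ => h1 i,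
      integral_finsetSum _ fun i _ => integrable_finsetSum _ fun j _ => h2 i j]
    have e1 (i : ι) : ∫ x : ι → ℝ, l i * (x i * e x) = 0 := by
      rw [integral_const_mul, (integrable_and_integral_coord_mul_gaussian i).2, mul_zero]
    have e2 (i : ι) : ∫ x : ι → ℝ, ∑ j, Q i j * (x i * x j * e x) = Q i i * ∫ x, e x := by
      rw [integral_finsetSum _ fun j _ => h2 i j]
      simp only [integral_const_mul, e,
        (integrable_and_integral_coord_mul_coord_mul_gaussian i _).2]
      simp
    simp only [e1, e2, Finset.sum_const_zero, add_zero]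
    rw [add_mul, Matrix.trace, Finset.sum_mul]
    rfl
  have hintg : Integrable fun x => (a + l ⬝ᵥ x + x ⬝ᵥ (Q *ᵥ x)) * e x := by
    simp only [hexp]
    exact ((he.const_mul a).add hs1).add hs2
  have hepos (x : ι → ℝ) : 0 ≤ e x := (Real.exp_pos _).le
  simp only [← ENNReal.ofReal_mul (h _)]
  rw [← ofReal_integral_eq_lintegral_ofReal hintg (.of_forall fun x => mul_nonneg (h x) (hepos x)),
    hint, ← ofReal_integral_eq_lintegral_ofReal he (.of_forall hepos),
    ENNReal.ofReal_mul' (integral_nonneg hepos)]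

theorem lintegral_mulVec {M : Matrix ι ι ℝ} (hM : M.det ≠ 0) {f : (ι → ℝ) → ℝ≥0∞}
    (hf : Measurable f) :
    ∫⁻ x, f x = ENNReal.ofReal |M.det| * ∫⁻ x, f (M *ᵥ x) := by
  have hmap := Real.map_matrix_volume_pi_eq_smul_volume_pi hM
  have : ∫⁻ x, f (M *ᵥ x) = ENNReal.ofReal |M.det⁻¹| * ∫⁻ x, f x := by
    rw [← smul_eq_mul, ← lintegral_smul_measure, ← hmap,
      lintegral_map hf (M.toLin').continuous_of_finiteDimensional.measurable]
    rfl
  rw [this, ← mul_assoc, ← ENNReal.ofReal_mul (abs_nonneg _), abs_inv,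
    mul_inv_cancel₀ (abs_ne_zero.2 hM), ENNReal.ofReal_one, one_mul]

open scoped MatrixOrder in
-- `R` is a square root of the covariance `P⁻¹`: the substitution `x = R z` turns the form `P` into
-- the standard one.
theorem Matrix.PosDef.exists_inv_eq_mul_transpose {P : Matrix ι ι ℝ} (hP : P.PosDef) :
    ∃ R : Matrix ι ι ℝ, R.det ≠ 0 ∧ R * Rᵀ = P⁻¹ ∧ Rᵀ * P * R = 1 := by
  obtain ⟨y, hy⟩ := CStarAlgebra.nonneg_iff_eq_star_mul_self.mp hP.inv.posSemidef.nonneg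
  have hy' : yᵀ * y = P⁻¹ := by rw [hy]; simp [star_eq_conjTranspose]
  have hdet : y.det ≠ 0 := by
    intro h0
    have := congrArg Matrix.det hy'
    rw [det_mul, h0, mul_zero] at this
    exact hP.inv.det_pos.ne this
  refine ⟨yᵀ, by rwa [det_transpose], by rwa [transpose_transpose], ?_⟩
  rw [transpose_transpose]
  have hPy : P = y⁻¹ * (yᵀ)⁻¹ := by
    rw [← Matrix.mul_inv_rev, hy', nonsing_inv_nonsing_inv _ (isUnit_iff_ne_zero.2 hP.det_pos.ne')]
  rw [hPy, ← Matrix.mul_assoc, mul_nonsing_inv _ (isUnit_iff_ne_zero.2 hdet), Matrix.one_mul,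
    nonsing_inv_mul _ (isUnit_iff_ne_zero.2 (by rwa [det_transpose]))]

/-- Second moments of the Gaussian distribution with mean `f` and covariance `ω P⁻¹`, in
unnormalized form. -/
theorem exists_lintegral_quadratic_mul_exp {P : Matrix ι ι ℝ} (hP : P.PosDef) (f : ι → ℝ) :
    ∃ c : ℝ≥0∞, ∀ (A : Matrix ι ι ℝ) (a ω : ℝ), A.PosSemidef → 0 ≤ a → 0 < ω →
      ∫⁻ x : ι → ℝ, ENNReal.ofReal (a + x ⬝ᵥ (A *ᵥ x)) *
          ENNReal.ofReal (Real.exp (-((x - f) ⬝ᵥ (P *ᵥ (x - f)) / (2 * ω)))) =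
        ENNReal.ofReal (a + f ⬝ᵥ (A *ᵥ f) + ω * (A * P⁻¹).trace) *
          (ENNReal.ofReal (√ω ^ Fintype.card ι) * c) := by
  obtain ⟨R, hdet, hRR, hRPR⟩ := hP.exists_inv_eq_mul_transpose
  -- The constant must not involve `A`, `a` or `ω`: the variance `ω` is integrated afterwards, so
  -- its power is kept explicit.
  refine ⟨ENNReal.ofReal |R.det| * ∫⁻ x : ι → ℝ, ENNReal.ofReal (Real.exp (-(x ⬝ᵥ x) / 2)),
    fun A a ω hA ha hω => ?_⟩
  have hAt : Aᵀ = A := by simpa [Matrix.IsHermitian] using hA.isHermitian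
  have hsω : 0 < √ω := Real.sqrt_pos.2 hω
  have hsq : √ω * √ω = ω := Real.mul_self_sqrt hω.le
  -- With `x = M z + f` the weight becomes standard Gaussian in `z`.
  set M := √ω • R with hMdef
  have hM : M.det ≠ 0 := by
    rw [hMdef, det_smul]
    exact mul_ne_zero (pow_ne_zero _ hsω.ne') hdet
  have hMabs : |M.det| = √ω ^ Fintype.card ι * |R.det| := by
    rw [hMdef, det_smul, abs_mul, abs_of_pos (pow_pos hsω _)]
  have hmeas : Measurable fun x : ι → ℝ => ENNReal.ofReal (a + (x + f) ⬝ᵥ (A *ᵥ (x + f))) *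
      ENNReal.ofReal (Real.exp (-((x + f - f) ⬝ᵥ (P *ᵥ (x + f - f)) / (2 * ω)))) := by
    have h1 : Continuous fun x : ι → ℝ => a + (x + f) ⬝ᵥ (A *ᵥ (x + f)) := by fun_prop
    have h2 : Continuous fun x : ι → ℝ =>
        Real.exp (-((x + f - f) ⬝ᵥ (P *ᵥ (x + f - f)) / (2 * ω))) := by fun_prop
    exact h1.measurable.ennreal_ofReal.mul h2.measurable.ennreal_ofReal
  rw [← lintegral_add_right_eq_self _ f, lintegral_mulVec hM hmeas]
  have hconj (B : Matrix ι ι ℝ) (x : ι → ℝ) :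
      (M *ᵥ x) ⬝ᵥ (B *ᵥ (M *ᵥ x)) = x ⬝ᵥ ((Mᵀ * B * M) *ᵥ x) := by
    rw [← mulVec_mulVec, ← mulVec_mulVec, dotProduct_mulVec x Mᵀ, vecMul_transpose]
  have hquad (x : ι → ℝ) : (M *ᵥ x + f) ⬝ᵥ (A *ᵥ (M *ᵥ x + f)) =
      f ⬝ᵥ (A *ᵥ f) + ((2 : ℝ) • (f ᵥ* (A * M))) ⬝ᵥ x + x ⬝ᵥ ((Mᵀ * A * M) *ᵥ x) := by
    have h1 : (M *ᵥ x) ⬝ᵥ (A *ᵥ f) = f ⬝ᵥ (A *ᵥ (M *ᵥ x)) := by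
      rw [dotProduct_comm, ← vecMul_transpose, hAt, ← dotProduct_mulVec]
    have h2 : (f ᵥ* (A * M)) ⬝ᵥ x = f ⬝ᵥ (A *ᵥ (M *ᵥ x)) := by
      rw [← dotProduct_mulVec, mulVec_mulVec]
    rw [mulVec_add, add_dotProduct, dotProduct_add, dotProduct_add, h1, hconj, smul_dotProduct,
      h2, smul_eq_mul]
    ring
  have hgauss (x : ι → ℝ) : (M *ᵥ x) ⬝ᵥ (P *ᵥ (M *ᵥ x)) / (2 * ω) = (x ⬝ᵥ x) / 2 := by
    have : (M *ᵥ x) ⬝ᵥ (P *ᵥ (M *ᵥ x)) = ω * (x ⬝ᵥ x) := by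
      have : Mᵀ * P * M = ω • (1 : Matrix ι ι ℝ) := by
        rw [hMdef, transpose_smul, Matrix.mul_smul, Matrix.smul_mul, Matrix.smul_mul,
          hRPR, smul_smul, hsq]
      rw [hconj, this, smul_mulVec, one_mulVec, dotProduct_smul, smul_eq_mul]
    rw [this]
    field_simp
  have htr : (Mᵀ * A * M).trace = ω * (A * P⁻¹).trace := by
    rw [← hRR, hMdef, transpose_smul, Matrix.smul_mul, Matrix.smul_mul, Matrix.mul_smul,
      smul_smul, hsq, trace_smul, smul_eq_mul, Matrix.mul_assoc, trace_mul_comm, Matrix.mul_assoc]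
  have hnn (x : ι → ℝ) : 0 ≤ a + f ⬝ᵥ (A *ᵥ f) + ((2 : ℝ) • (f ᵥ* (A * M))) ⬝ᵥ x +
      x ⬝ᵥ ((Mᵀ * A * M) *ᵥ x) := by
    have := hA.dotProduct_mulVec_nonneg (M *ᵥ x + f)
    rw [star_trivial, hquad] at this
    linarith
  have key := lintegral_quadratic_mul_gaussian hnn
  rw [htr] at key
  simp only [add_sub_cancel_right, hgauss, hquad]
  simp only [← add_assoc, ← neg_div]
  rw [key, hMabs, ENNReal.ofReal_mul (by positivity)]
  ring

end Gaussian

/-! ### One-dimensional inverse Wishart distributions -/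

section Unit

theorem lintegral_symLebesgue_unit {f : Matrix Unit Unit ℝ → ℝ≥0∞} (hf : Measurable f) :
    ∫⁻ C, f C ∂symLebesgue Unit = ∫⁻ x : ℝ, f (diagonal fun _ => x) := by
  rw [lintegral_symLebesgue hf]
  have hd : Measurable fun x : ℝ => f (diagonal fun _ : Unit => x) :=
    hf.comp (Continuous.measurable (by fun_prop))
  rw [← (volume_preserving_funUnique (Sym2 Unit) ℝ).lintegral_comp hd]
  refine lintegral_congr fun y => congrArg f ?_
  ext i j
  rw [Subsingleton.elim j i, diagonal_apply_eq, symMatrix_apply]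
  exact congrArg y (Subsingleton.elim _ _)

/-- In dimension one the inverse Wishart law is inverse gamma with shape `δ / 2` and scale `D / 2`.
-/
theorem invWishartKernel_unit (δ : ℝ) (D : Matrix Unit Unit ℝ) (x : ℝ) :
    invWishartKernel δ D (diagonal fun _ => x) =
      (Set.Ioi (0 : ℝ)).indicator (fun x => ENNReal.ofReal
        (x ^ (-(δ / 2) - 1) * Real.exp (-(D () () / 2 / x)))) x := by
  by_cases hx : 0 < x
  · have hC : (diagonal fun _ : Unit => x).PosDef := posDef_diagonal_iff.2 fun _ => hx
    have hinv : (diagonal fun _ : Unit => x)⁻¹ = diagonal fun _ : Unit => x⁻¹ := by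
      refine inv_eq_right_inv ?_
      rw [diagonal_mul_diagonal, mul_inv_cancel₀ hx.ne', diagonal_one]
    rw [invWishartKernel_of_posDef _ _ hC, Set.indicator_of_mem (by exact hx), hinv]
    have htr : (D * diagonal fun _ : Unit => x⁻¹).trace = D () () * x⁻¹ := by
      simp [trace]
    rw [htr]
    congr 2
    · simp only [det_unique, Fintype.card_unit, diagonal_apply_eq]
      congr 1
      push_cast
      ring
    · congr 1
      ring
  · have hC : ¬ (diagonal fun _ : Unit => x).PosDef := fun h => hx (posDef_diagonal_iff.1 h ())
    rw [invWishartKernel_of_not_posDef _ _ hC, Set.indicator_of_notMem (by exact hx)]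

theorem lintegral_mul_invWishartKernel_unit (δ : ℝ) (D : Matrix Unit Unit ℝ) {g : ℝ → ℝ≥0∞}
    (hg : Measurable g) :
    ∫⁻ C, g (C () ()) * invWishartKernel δ D C ∂symLebesgue Unit =
      ∫⁻ x in Set.Ioi (0 : ℝ), g x *
        ENNReal.ofReal (x ^ (-(δ / 2) - 1) * Real.exp (-(D () () / 2 / x))) := by
  have hm : Measurable fun C : Matrix Unit Unit ℝ => g (C () ()) * invWishartKernel δ D C :=
    (hg.comp (Matrix.measurable_entry _ _)).mul (measurable_invWishartKernel δ D)
  rw [lintegral_symLebesgue_unit hm, ← lintegral_indicator measurableSet_Ioi]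
  refine lintegral_congr fun x => ?_
  rw [invWishartKernel_unit, diagonal_apply_eq]
  by_cases hx : x ∈ Set.Ioi (0 : ℝ)
  · simp only [Set.indicator_of_mem hx]
  · simp only [Set.indicator_of_notMem hx, mul_zero]

/-- The mean of the one-dimensional inverse Wishart distribution, in unnormalized form. -/
theorem lintegral_entry_mul_invWishartKernel_unit {δ : ℝ} (hδ : 2 < δ) {D : Matrix Unit Unit ℝ}
    (hD : 0 < D () ()) :
    ∫⁻ C, ENNReal.ofReal (C () ()) * invWishartKernel δ D C ∂symLebesgue Unit =
      ENNReal.ofReal (D () () / (δ - 2)) *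
        ∫⁻ C, invWishartKernel δ D C ∂symLebesgue Unit := by
  have h := lintegral_affine_mul_inverseGamma (s := δ / 2) (r := D () () / 2) (a := 0) (b := 1)
    (by linarith) (by positivity) le_rfl zero_le_one
  have h1 := lintegral_mul_invWishartKernel_unit δ D (g := fun _ => 1) measurable_const
  simp only [one_mul] at h1
  simp only [zero_add, one_mul] at h
  rw [lintegral_mul_invWishartKernel_unit δ D ENNReal.measurable_ofReal, h1, h]
  congr 2
  have : δ - 2 ≠ 0 := by linarith
  have : δ / 2 - 1 ≠ 0 := by linarith
  field_simp

end Unit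

/-! ### The conditional mean of a diagonal entry given the complementary block -/

section CondMean

variable {ι : Type*} [Fintype ι] [DecidableEq ι]

omit [DecidableEq ι] in
theorem Matrix.unit_mul_mul_transpose_apply (G : Matrix Unit ι ℝ) (A : Matrix ι ι ℝ) :
    (G * A * Gᵀ) () () = G () ⬝ᵥ (A *ᵥ G ()) := by
  rw [Matrix.mul_assoc]
  rfl

theorem Matrix.trace_mul_inv_nonneg {A P : Matrix ι ι ℝ} (hA : A.PosSemidef) (hP : P.PosDef) :
    0 ≤ (A * P⁻¹).trace := by
  obtain ⟨R, -, hR, -⟩ := hP.exists_inv_eq_mul_transpose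
  rw [← hR, ← Matrix.mul_assoc, trace_mul_comm, ← Matrix.mul_assoc]
  simpa using (hA.conjTranspose_mul_mul_same R).trace_nonneg

/-- The integral over the regression coefficient and the Schur complement of an affine function of
the last diagonal entry. -/
theorem exists_lintegral_lintegral_mul_invWishartKernel_unit {δ : ℝ}
    (hδ : 2 < δ + Fintype.card ι) {P : Matrix ι ι ℝ} (hP : P.PosDef) (F : Matrix Unit ι ℝ)
    {V : Matrix Unit Unit ℝ} (hV : 0 < V () ()) :
    ∃ c : ℝ≥0∞, ∀ (A : Matrix ι ι ℝ) (a t : ℝ), A.PosSemidef → 0 ≤ a → 0 ≤ t →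
      ∫⁻ Γ : Unit → ι → ℝ, (∫⁻ C,
          ENNReal.ofReal (a + t * C () () + (Matrix.of Γ * A * (Matrix.of Γ)ᵀ) () ()) *
            invWishartKernel (δ + 2 * (Fintype.card ι : ℝ))
              (V + (Matrix.of Γ - F) * P * (Matrix.of Γ - F)ᵀ) C ∂symLebesgue Unit) =
        ENNReal.ofReal (a + (F * A * Fᵀ) () () +
          (t + (A * P⁻¹).trace) * (V () () / (δ + Fintype.card ι - 2))) * c := by
  obtain ⟨c, hc⟩ := exists_lintegral_quadratic_mul_exp hP (F ())
  set q : ℕ := Fintype.card ι with hq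
  -- The shape left for `x` once `Γ` is integrated out: `(δ + 2 q) / 2` from the kernel, less `q /
  -- 2` from the Gaussian normalization `√x ^ q`.
  set s : ℝ := (δ + q) / 2 with hs
  set r : ℝ := V () () / 2 with hr
  have hs1 : 1 < s := by rw [hs]; linarith
  have hr0 : 0 < r := by positivity
  refine ⟨(∫⁻ x in Set.Ioi (0 : ℝ), ENNReal.ofReal (x ^ (-s - 1) * Real.exp (-(r / x)))) * c,
    fun A a t hA ha ht => ?_⟩
  have hfA : 0 ≤ F () ⬝ᵥ (A *ᵥ F ()) := by simpa using hA.dotProduct_mulVec_nonneg (F ())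
  have htr : 0 ≤ (A * P⁻¹).trace := Matrix.trace_mul_inv_nonneg hA hP
  let g : (ι → ℝ) → ℝ → ℝ≥0∞ := fun γ x =>
    ENNReal.ofReal (a + t * x + γ ⬝ᵥ (A *ᵥ γ)) *
      ENNReal.ofReal (x ^ (-((δ + 2 * (q : ℝ)) / 2) - 1) *
        Real.exp (-((V () () + (γ - F ()) ⬝ᵥ (P *ᵥ (γ - F ()))) / 2 / x)))
  have hg : Measurable fun p : (ι → ℝ) × ℝ => g p.1 p.2 := by
    have h1 : Measurable fun p : (ι → ℝ) × ℝ => a + t * p.2 + p.1 ⬝ᵥ (A *ᵥ p.1) :=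
      Continuous.measurable (by fun_prop)
    have h2 : Measurable fun p : (ι → ℝ) × ℝ =>
        V () () + (p.1 - F ()) ⬝ᵥ (P *ᵥ (p.1 - F ())) :=
      Continuous.measurable (by fun_prop)
    exact h1.ennreal_ofReal.mul ((measurable_snd.pow_const _).mul
      ((h2.div_const 2).div measurable_snd).neg.exp).ennreal_ofReal
  calc
    _ = ∫⁻ Γ : Unit → ι → ℝ, ∫⁻ x in Set.Ioi (0 : ℝ), g (Γ ()) x := by
      refine lintegral_congr fun Γ => ?_
      have hm : Measurable fun x : ℝ =>
          ENNReal.ofReal (a + t * x + (Matrix.of Γ * A * (Matrix.of Γ)ᵀ) () ()) := by fun_prop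
      rw [lintegral_mul_invWishartKernel_unit _ _ hm]
      simp only [Matrix.add_apply, Matrix.unit_mul_mul_transpose_apply]
      rfl
    _ = ∫⁻ γ : ι → ℝ, ∫⁻ x in Set.Ioi (0 : ℝ), g γ x :=
      (volume_preserving_funUnique Unit (ι → ℝ)).lintegral_comp
        (f := fun γ => ∫⁻ x in Set.Ioi (0 : ℝ), g γ x) hg.lintegral_prod_right'
    -- Tonelli: for fixed `x` the integrand in `γ` is a Gaussian weight with mean `F ()` and
    -- covariance `x P⁻¹`.
    _ = ∫⁻ x in Set.Ioi (0 : ℝ), ∫⁻ γ : ι → ℝ, g γ x :=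
      lintegral_lintegral_swap hg.aemeasurable
    _ = ∫⁻ x in Set.Ioi (0 : ℝ), ENNReal.ofReal (a + F () ⬝ᵥ (A *ᵥ F ()) +
          (t + (A * P⁻¹).trace) * x) *
          ENNReal.ofReal (x ^ (-s - 1) * Real.exp (-(r / x))) * c := by
      refine setLIntegral_congr_fun measurableSet_Ioi fun x hx => ?_
      have hx0 : (0 : ℝ) < x := hx
      have hsplit (γ : ι → ℝ) : g γ x =
          ENNReal.ofReal (x ^ (-((δ + 2 * (q : ℝ)) / 2) - 1) * Real.exp (-(r / x))) *
            (ENNReal.ofReal (a + t * x + γ ⬝ᵥ (A *ᵥ γ)) *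
              ENNReal.ofReal
                (Real.exp (-((γ - F ()) ⬝ᵥ (P *ᵥ (γ - F ())) / (2 * x))))) := by
        have hexp : Real.exp (-((V () () + (γ - F ()) ⬝ᵥ (P *ᵥ (γ - F ()))) / 2 / x)) =
            Real.exp (-(r / x)) *
              Real.exp (-((γ - F ()) ⬝ᵥ (P *ᵥ (γ - F ())) / (2 * x))) := by
          rw [← Real.exp_add]
          congr 1
          rw [hr]
          field_simp
          ring
        simp only [g]
        rw [hexp, ← mul_assoc, ENNReal.ofReal_mul (by positivity)]
        ring
      have hpow : √x ^ q * x ^ (-((δ + 2 * (q : ℝ)) / 2) - 1) = x ^ (-s - 1) := by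
        rw [Real.sqrt_eq_rpow, ← Real.rpow_natCast, ← Real.rpow_mul hx0.le,
          ← Real.rpow_add hx0, hs]
        congr 1
        ring
      simp only [hsplit]
      rw [lintegral_const_mul' _ _ ENNReal.ofReal_ne_top, hc A (a + t * x) x hA (by positivity) hx0,
        ← hpow, mul_assoc (√x ^ q), ENNReal.ofReal_mul (by positivity : 0 ≤ √x ^ q)]
      have : a + t * x + F () ⬝ᵥ (A *ᵥ F ()) + x * (A * P⁻¹).trace =
          a + F () ⬝ᵥ (A *ᵥ F ()) + (t + (A * P⁻¹).trace) * x := by ring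
      rw [this]
      ring
    _ = _ := by
      have hm : Measurable fun x : ℝ => ENNReal.ofReal (a + F () ⬝ᵥ (A *ᵥ F ()) +
          (t + (A * P⁻¹).trace) * x) *
          ENNReal.ofReal (x ^ (-s - 1) * Real.exp (-(r / x))) := by
        have h1 : Measurable fun x : ℝ => a + F () ⬝ᵥ (A *ᵥ F ()) + (t + (A * P⁻¹).trace) * x := by
          fun_prop
        exact h1.ennreal_ofReal.mul ((measurable_id.pow_const _).mul
          (measurable_const.div measurable_id).neg.exp).ennreal_ofReal
      rw [lintegral_mul_const _ hm,
        lintegral_affine_mul_inverseGamma hs1 hr0 (by positivity) (by positivity),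
        Matrix.unit_mul_mul_transpose_apply, mul_assoc]
      congr 3
      have h1 : δ + q - 2 ≠ 0 := by linarith
      have h2 : s - 1 = (δ + q - 2) / 2 := by rw [hs]; ring
      rw [h2, hr]
      field_simp

/-- The conditional mean of the last diagonal entry of an inverse Wishart matrix given its leading
block, tested against functions of the leading block. -/
theorem lintegral_entry_mul_invWishartKernel_schurMatrix {δ : ℝ}
    (hδ : 2 < δ + Fintype.card ι) {P : Matrix ι ι ℝ} (hP : P.PosDef) (F : Matrix Unit ι ℝ)
    {V : Matrix Unit Unit ℝ} (hV : 0 < V () ()) {φ : Matrix ι ι ℝ → ℝ≥0∞} (hφ : Measurable φ)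
    (hφtop : ∀ A, φ A ≠ ∞) :
    ∫⁻ M, φ M.toBlocks₁₁ * ENNReal.ofReal (M (Sum.inr ()) (Sum.inr ())) *
        invWishartKernel δ (schurMatrix P F V) M ∂symLebesgue (ι ⊕ Unit) =
      ∫⁻ M, φ M.toBlocks₁₁ * ENNReal.ofReal ((F * M.toBlocks₁₁ * Fᵀ) () () +
          (1 + (M.toBlocks₁₁ * P⁻¹).trace) * (V () () / (δ + Fintype.card ι - 2))) *
        invWishartKernel δ (schurMatrix P F V) M ∂symLebesgue (ι ⊕ Unit) := by
  have hPt : Pᵀ = P := by simpa [Matrix.IsHermitian] using hP.isHermitian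
  obtain ⟨c₀, hc₀⟩ := exists_lintegral_invWishartKernel_schurMatrix δ hPt F V
  obtain ⟨c, hc⟩ := exists_lintegral_lintegral_mul_invWishartKernel_unit hδ hP F hV
  have hb : Measurable fun M : Matrix (ι ⊕ Unit) (ι ⊕ Unit) ℝ => M.toBlocks₁₁ :=
    Matrix.measurable_of_entries fun i j => Matrix.measurable_entry _ _
  let m : Matrix ι ι ℝ → ℝ := fun A => (F * A * Fᵀ) () () +
    (1 + (A * P⁻¹).trace) * (V () () / (δ + Fintype.card ι - 2))
  have hm : Measurable m := by
    have h1 : Measurable fun A : Matrix ι ι ℝ => F * A * Fᵀ :=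
      Continuous.measurable (by fun_prop)
    have h2 : Measurable fun A : Matrix ι ι ℝ => (A * P⁻¹).trace :=
      Continuous.measurable (by fun_prop)
    exact ((Matrix.measurable_entry _ _).comp h1).add ((h2.const_add 1).mul_const _)
  rw [hc₀ (fun M => φ M.toBlocks₁₁ * ENNReal.ofReal (M (Sum.inr ()) (Sum.inr ())))
      ((hφ.comp hb).mul (Matrix.measurable_entry _ _).ennreal_ofReal),
    hc₀ (fun M => φ M.toBlocks₁₁ * ENNReal.ofReal (m M.toBlocks₁₁))
      ((hφ.comp hb).mul (hm.comp hb).ennreal_ofReal)]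
  congr 1
  refine lintegral_congr fun A => ?_
  by_cases hA : A.PosDef
  swap
  · rw [invWishartKernel_of_not_posDef _ _ hA, zero_mul, zero_mul]
  congr 1
  -- Two instances with the same constant: this one integrates the last diagonal entry `C + Γ A Γᵀ`,
  -- and the next, with zero matrix and `a = 1`, gives the total mass. Comparing them yields the
  -- conditional mean without any division.
  have h1 := hc A 0 1 hA.posSemidef le_rfl zero_le_one
  have h0 := hc 0 1 0 Matrix.PosSemidef.zero zero_le_one le_rfl
  simp only [one_mul, zero_add, zero_mul, Matrix.mul_zero, Matrix.zero_mul, Matrix.zero_apply,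
    add_zero, trace_zero, ENNReal.ofReal_one] at h0 h1
  have e1 (Γ : Unit → ι → ℝ) (C : Matrix Unit Unit ℝ) :
      schurMatrix A (Matrix.of Γ) C (Sum.inr ()) (Sum.inr ()) =
        C () () + (Matrix.of Γ * A * (Matrix.of Γ)ᵀ) () () := rfl
  have e2 (Γ : Unit → ι → ℝ) (C : Matrix Unit Unit ℝ) :
      (schurMatrix A (Matrix.of Γ) C).toBlocks₁₁ = A := rfl
  simp only [e1, e2, mul_assoc]
  simp only [lintegral_const_mul' _ _ (hφtop A), lintegral_const_mul' _ _ ENNReal.ofReal_ne_top]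
  rw [h0, h1]

end CondMean

/-! ### Quadratic forms of symmetric matrices -/

section Quadratic

variable {ι κ : Type*} [Fintype ι] [DecidableEq ι] [Fintype κ] [DecidableEq κ]

/-- The quadratic form of a matrix. -/
def Matrix.quad (A : Matrix ι ι ℝ) (v : ι → ℝ) : ℝ := v ⬝ᵥ (A *ᵥ v)

omit [DecidableEq ι] in
theorem Matrix.measurable_quad (v : ι → ℝ) : Measurable fun A : Matrix ι ι ℝ => A.quad v := by
  unfold Matrix.quad
  exact Continuous.measurable (by fun_prop)

/-- Polarization; it also covers `i = j`, where the first vector is twice a basis vector. -/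
theorem Matrix.apply_eq_quad {A : Matrix ι ι ℝ} (hA : Aᵀ = A) (i j : ι) :
    A i j = (A.quad (Pi.single i 1 + Pi.single j 1) - A.quad (Pi.single i 1) -
      A.quad (Pi.single j 1)) / 2 := by
  have h : A j i = A i j := congrFun (congrFun hA i) j
  simp only [Matrix.quad, mulVec_add, dotProduct_add, add_dotProduct, mulVec_single_one,
    single_one_dotProduct, col_apply, h]
  ring

omit [DecidableEq ι] in
theorem Matrix.of_mul_mul_transpose_apply (v : ι → ℝ) (A : Matrix ι ι ℝ) :
    ((Matrix.of fun _ : Unit => v) * A * (Matrix.of fun _ : Unit => v)ᵀ) () () = A.quad v := by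
  rw [Matrix.mul_assoc]
  rfl

omit [DecidableEq ι] in
-- An explicit right inverse of a nonzero row vector, as required to compress along it.
theorem Matrix.of_mul_of_inv_smul_eq_one {v : ι → ℝ} (hv : v ≠ 0) :
    (Matrix.of fun _ : Unit => v) * (Matrix.of fun (i : ι) (_ : Unit) => (v ⬝ᵥ v)⁻¹ * v i) = 1 := by
  have h : v ⬝ᵥ v ≠ 0 := by rwa [ne_eq, dotProduct_self_eq_zero]
  ext
  simp only [Matrix.mul_apply, of_apply, one_apply_eq]
  calc ∑ i, v i * ((v ⬝ᵥ v)⁻¹ * v i) = (v ⬝ᵥ v)⁻¹ * (v ⬝ᵥ v) := by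
        rw [dotProduct, Finset.mul_sum]
        exact Finset.sum_congr rfl fun i _ => by ring
    _ = 1 := inv_mul_cancel₀ h

omit [DecidableEq ι] in
theorem Matrix.PosDef.quad_pos {A : Matrix ι ι ℝ} (hA : A.PosDef) {v : ι → ℝ} (hv : v ≠ 0) :
    0 < A.quad v := by
  simpa [Matrix.quad] using hA.dotProduct_mulVec_pos hv

omit [DecidableEq ι] in
theorem Matrix.PosSemidef.quad_nonneg {A : Matrix ι ι ℝ} (hA : A.PosSemidef) (v : ι → ℝ) :
    0 ≤ A.quad v := by
  simpa [Matrix.quad] using hA.dotProduct_mulVec_nonneg v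

omit [Fintype ι] [DecidableEq ι] in
theorem Matrix.PosDef.transpose_eq {A : Matrix ι ι ℝ} (hA : A.PosDef) : Aᵀ = A := by
  simpa [Matrix.IsHermitian] using hA.isHermitian

theorem schurMatrix_posDef {P : Matrix ι ι ℝ} {V : Matrix κ κ ℝ} (hP : P.PosDef) (hV : V.PosDef)
    (F : Matrix κ ι ℝ) : (schurMatrix P F V).PosDef := by
  rw [schurMatrix_eq hP.transpose_eq]
  refine (posDef_fromBlocks_zero_iff.2 ⟨hP, hV⟩).mul_mul_transpose_of_mul_eq_one
    (R := fromBlocks 1 0 (-F) 1) ?_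
  simp [fromBlocks_multiply]

omit [DecidableEq κ] in
-- Used with a row vector `L`: the second block shrinks to one entry while the conditioning block
-- and its scale `P` stay intact.
theorem fromBlocks_one_mul_schurMatrix (P : Matrix ι ι ℝ) (F : Matrix κ ι ℝ) (V : Matrix κ κ ℝ)
    {α : Type*} [Fintype α] [DecidableEq α] (L : Matrix α κ ℝ) :
    (fromBlocks 1 0 0 L : Matrix (ι ⊕ α) (ι ⊕ κ) ℝ) * schurMatrix P F V *
        (fromBlocks 1 0 0 L : Matrix (ι ⊕ α) (ι ⊕ κ) ℝ)ᵀ =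
      schurMatrix P (L * F) (L * V * Lᵀ) := by
  simp only [schurMatrix, fromBlocks_transpose, fromBlocks_multiply]
  congr 1 <;> simp [Matrix.mul_assoc, Matrix.mul_add, Matrix.add_mul]

end Quadratic

/-! ### Means of quadratic forms of inverse Wishart matrices -/

section QuadraticMean

variable {ι : Type*} [Fintype ι] [DecidableEq ι]

/-- Compression along the row vector `v` makes the quadratic form a one-dimensional inverse Wishart
variable, whose mean is known. Integrability of the states rests on this. -/
theorem lintegral_quad_mul_invWishartKernel {δ : ℝ} (hδ : 2 < δ) {D : Matrix ι ι ℝ}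
    (hD : D.PosDef) {v : ι → ℝ} (hv : v ≠ 0) :
    ∫⁻ A, ENNReal.ofReal (A.quad v) * invWishartKernel δ D A ∂symLebesgue ι =
      ENNReal.ofReal (D.quad v / (δ - 2)) * ∫⁻ A, invWishartKernel δ D A ∂symLebesgue ι := by
  obtain ⟨c, hc⟩ := exists_lintegral_invWishartKernel_compression δ hD
    (Matrix.of_mul_of_inv_smul_eq_one hv)
  have h1 := hc (fun C => ENNReal.ofReal (C () ())) (Matrix.measurable_entry _ _).ennreal_ofReal
  have h2 := hc (fun _ => 1) measurable_const
  simp only [one_mul, Matrix.of_mul_mul_transpose_apply] at h1 h2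
  have hpos := hD.quad_pos hv
  rw [← Matrix.of_mul_mul_transpose_apply] at hpos ⊢
  rw [h1, h2, lintegral_entry_mul_invWishartKernel_unit hδ hpos]
  ring

/-- The conditional mean of a quadratic form of the second diagonal block given the first, tested
against functions of the first block. -/
theorem lintegral_quad_toBlocks₂₂_mul_invWishartKernel {κ : Type*} [Fintype κ] [DecidableEq κ]
    {δ : ℝ} (hδ : 2 < δ + Fintype.card ι) {P : Matrix ι ι ℝ} (hP : P.PosDef) (F : Matrix κ ι ℝ)
    {V : Matrix κ κ ℝ} (hV : V.PosDef) {v : κ → ℝ} (hv : v ≠ 0) {φ : Matrix ι ι ℝ → ℝ≥0∞}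
    (hφ : Measurable φ) (hφtop : ∀ A, φ A ≠ ∞) :
    ∫⁻ M, φ M.toBlocks₁₁ * ENNReal.ofReal (M.toBlocks₂₂.quad v) *
        invWishartKernel δ (schurMatrix P F V) M ∂symLebesgue (ι ⊕ κ) =
      ∫⁻ M, φ M.toBlocks₁₁ * ENNReal.ofReal ((F * M.toBlocks₁₁ * Fᵀ +
          ((1 + (M.toBlocks₁₁ * P⁻¹).trace) * (δ + Fintype.card ι - 2)⁻¹) • V).quad v) *
        invWishartKernel δ (schurMatrix P F V) M ∂symLebesgue (ι ⊕ κ) := by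
  let L : Matrix Unit κ ℝ := Matrix.of fun _ : Unit => v
  let R : Matrix κ Unit ℝ := Matrix.of fun (i : κ) (_ : Unit) => (v ⬝ᵥ v)⁻¹ * v i
  have hLR : L * R = 1 := Matrix.of_mul_of_inv_smul_eq_one hv
  have hLR' : (fromBlocks 1 0 0 L : Matrix (ι ⊕ Unit) (ι ⊕ κ) ℝ) *
      (fromBlocks 1 0 0 R : Matrix (ι ⊕ κ) (ι ⊕ Unit) ℝ) = 1 := by
    simp [fromBlocks_multiply, hLR]
  -- Both sides depend on `M` only through its compression, so both reduce to the case of a single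
  -- last entry with one common constant.
  obtain ⟨c, hc⟩ := exists_lintegral_invWishartKernel_compression δ (schurMatrix_posDef hP hV F)
    hLR'
  rw [fromBlocks_one_mul_schurMatrix] at hc
  have hb : Measurable fun M : Matrix (ι ⊕ Unit) (ι ⊕ Unit) ℝ => M.toBlocks₁₁ :=
    Matrix.measurable_of_entries fun i j => Matrix.measurable_entry _ _
  have hVpos : 0 < (L * V * Lᵀ) () () := by
    rw [Matrix.of_mul_mul_transpose_apply]
    exact hV.quad_pos hv
  let m : Matrix ι ι ℝ → ℝ := fun A => (L * F * A * (L * F)ᵀ) () () +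
    (1 + (A * P⁻¹).trace) * ((L * V * Lᵀ) () () / (δ + Fintype.card ι - 2))
  have hm : Measurable m := by
    have h1 : Measurable fun A : Matrix ι ι ℝ => L * F * A * (L * F)ᵀ :=
      Continuous.measurable (by fun_prop)
    have h2 : Measurable fun A : Matrix ι ι ℝ => (A * P⁻¹).trace :=
      Continuous.measurable (by fun_prop)
    exact ((Matrix.measurable_entry _ _).comp h1).add ((h2.const_add 1).mul_const _)
  have hmq (A : Matrix ι ι ℝ) : (F * A * Fᵀ +
      ((1 + (A * P⁻¹).trace) * (δ + Fintype.card ι - 2)⁻¹) • V).quad v = m A := by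
    have h1 : (L * F * A * (L * F)ᵀ) () () = (F * A * Fᵀ).quad v := by
      rw [← Matrix.of_mul_mul_transpose_apply]
      simp only [L, transpose_mul, Matrix.mul_assoc]
    simp only [m, h1]
    rw [Matrix.of_mul_mul_transpose_apply]
    simp only [Matrix.quad, add_mulVec, smul_mulVec, dotProduct_add, dotProduct_smul, smul_eq_mul]
    ring
  have hB (M : Matrix (ι ⊕ κ) (ι ⊕ κ) ℝ) :
      (fromBlocks 1 0 0 L : Matrix (ι ⊕ Unit) (ι ⊕ κ) ℝ) * M *
        (fromBlocks 1 0 0 L : Matrix (ι ⊕ Unit) (ι ⊕ κ) ℝ)ᵀ =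
      fromBlocks M.toBlocks₁₁ (M.toBlocks₁₂ * Lᵀ) (L * M.toBlocks₂₁) (L * M.toBlocks₂₂ * Lᵀ) := by
    conv_lhs => rw [← fromBlocks_toBlocks M]
    simp [fromBlocks_transpose, fromBlocks_multiply]
  have h1 := hc (fun M => φ M.toBlocks₁₁ * ENNReal.ofReal (M (Sum.inr ()) (Sum.inr ())))
    ((hφ.comp hb).mul (Matrix.measurable_entry _ _).ennreal_ofReal)
  have h2 := hc (fun M => φ M.toBlocks₁₁ * ENNReal.ofReal (m M.toBlocks₁₁))
      ((hφ.comp hb).mul (hm.comp hb).ennreal_ofReal)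
  simp only [hB, toBlocks_fromBlocks₁₁, fromBlocks_apply₂₂] at h1 h2
  have hq (B : Matrix κ κ ℝ) : (L * B * Lᵀ) () () = B.quad v :=
    Matrix.of_mul_mul_transpose_apply v B
  simp only [hq] at h1
  simp only [hmq]
  rw [h1, h2, lintegral_entry_mul_invWishartKernel_schurMatrix hδ hP _ hVpos hφ hφtop]

end QuadraticMean

/-! ### The process -/

section Autoregression

variable {q : ℕ}

/-- The regression function of the process. -/
def iwarCondMean (n : ℝ) (F S A : Matrix (Fin q) (Fin q) ℝ) : Matrix (Fin q) (Fin q) ℝ :=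
  F * A * Fᵀ + ((n / (n + (q : ℝ))) * (1 + (A * (n • S)⁻¹).trace)) • (S - F * S * Fᵀ)

theorem measurable_iwarCondMean (n : ℝ) (F S : Matrix (Fin q) (Fin q) ℝ) :
    Measurable (iwarCondMean n F S) := by
  unfold iwarCondMean
  exact Continuous.measurable (by fun_prop)

theorem iwarCondMean_posSemidef {n : ℝ} (hn : 0 < n) {F S A : Matrix (Fin q) (Fin q) ℝ}
    (hS : S.PosDef) (hV : (S - F * S * Fᵀ).PosDef) (hA : A.PosDef) :
    (iwarCondMean n F S A).PosSemidef := by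
  have htr := Matrix.trace_mul_inv_nonneg hA.posSemidef (hS.smul hn)
  have h1 : (F * A * Fᵀ).PosSemidef := by
    simpa using hA.posSemidef.mul_mul_conjTranspose_same F
  exact h1.add (hV.posSemidef.smul (by positivity))

/-- This identifies `F` as the regression coefficient of the second block of the scale on the first,
and `n (S - F S Fᵀ)` as the Schur complement. -/
theorem iwar_scale_eq_schurMatrix {n : ℝ} {F S : Matrix (Fin q) (Fin q) ℝ} (hS : S.PosDef) :
    n • fromBlocks S (S * Fᵀ) (F * S) S = schurMatrix (n • S) F (n • (S - F * S * Fᵀ)) := by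
  rw [schurMatrix, fromBlocks_smul]
  congr 1
  · simp [transpose_mul, hS.transpose_eq]
  · simp
  · simp [smul_sub]

theorem exists_lintegral_iwarPairLaw {n : ℝ} {F S : Matrix (Fin q) (Fin q) ℝ} (hS : S.PosDef) :
    ∃ c : ℝ≥0∞, ∀ f : Matrix (Fin q) (Fin q) ℝ × Matrix (Fin q) (Fin q) ℝ → ℝ≥0∞, Measurable f →
      ∫⁻ p, f p ∂iwarPairLaw n F S =
        c * ∫⁻ M, f (M.toBlocks₁₁, M.toBlocks₂₂) *
          invWishartKernel (n + 2) (schurMatrix (n • S) F (n • (S - F * S * Fᵀ))) M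
            ∂symLebesgue (Fin q ⊕ Fin q) := by
  obtain ⟨c, hc⟩ := exists_ofReal_invWishartDensity_eq (n + 2)
    (schurMatrix (n • S) F (n • (S - F * S * Fᵀ)))
  refine ⟨c, fun f hf => ?_⟩
  have hb : Measurable fun M : Matrix (Fin q ⊕ Fin q) (Fin q ⊕ Fin q) ℝ =>
      (M.toBlocks₁₁, M.toBlocks₂₂) :=
    (Matrix.measurable_of_entries fun i j => Matrix.measurable_entry _ _).prodMk
      (Matrix.measurable_of_entries fun i j => Matrix.measurable_entry _ _)
  have hk := measurable_invWishartKernel (n + 2)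
    (schurMatrix (n • S) F (n • (S - F * S * Fᵀ)))
  rw [iwarPairLaw, iwar_scale_eq_schurMatrix hS, lintegral_map hf hb, invWishart]
  simp only [hc]
  have hfb : Measurable fun M : Matrix (Fin q ⊕ Fin q) (Fin q ⊕ Fin q) ℝ =>
      f (M.toBlocks₁₁, M.toBlocks₂₂) := hf.comp hb
  rw [lintegral_withDensity_eq_lintegral_mul _ (hk.const_mul c) hfb,
    ← lintegral_const_mul c (f := fun M : Matrix (Fin q ⊕ Fin q) (Fin q ⊕ Fin q) ℝ =>
      f (M.toBlocks₁₁, M.toBlocks₂₂) * invWishartKernel _ _ M) (hfb.mul hk)]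
  refine lintegral_congr fun M => ?_
  simp only [Pi.mul_apply]
  ring

variable {Ω : Type*} [MeasurableSpace Ω] {P : Measure Ω} {n : ℝ}
  {F S : Matrix (Fin q) (Fin q) ℝ} {X : ℕ → Ω → Matrix (Fin q) (Fin q) ℝ}

theorem IsIWAR1.exists_lintegral_pair (hX : IsIWAR1 P n F S X) (hS : S.PosDef) (t : ℕ) :
    ∃ c : ℝ≥0∞, ∀ f : Matrix (Fin q) (Fin q) ℝ × Matrix (Fin q) (Fin q) ℝ → ℝ≥0∞, Measurable f →
      ∫⁻ ω, f (X t ω, X (t + 1) ω) ∂P =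
        c * ∫⁻ M, f (M.toBlocks₁₁, M.toBlocks₂₂) *
          invWishartKernel (n + 2) (schurMatrix (n • S) F (n • (S - F * S * Fᵀ))) M
            ∂symLebesgue (Fin q ⊕ Fin q) := by
  obtain ⟨c, hc⟩ := exists_lintegral_iwarPairLaw (n := n) (F := F) hS
  refine ⟨c, fun f hf => ?_⟩
  rw [← hc f hf, ← hX.pair_law t,
    lintegral_map hf ((hX.measurable t).prodMk (hX.measurable (t + 1)))]

/-- The marginal law of a state is that of the leading block. The constant stays unknown; when
needed, it is controlled by taking `f = 1`. -/
theorem IsIWAR1.exists_lintegral_state (hX : IsIWAR1 P n F S X) (hn : 0 < n) (hS : S.PosDef)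
    (hV : (S - F * S * Fᵀ).PosDef) (t : ℕ) :
    ∃ c : ℝ≥0∞, ∀ f : Matrix (Fin q) (Fin q) ℝ → ℝ≥0∞, Measurable f →
      ∫⁻ ω, f (X t ω) ∂P =
        c * ∫⁻ A, f A * invWishartKernel (n + 2) (n • S) A ∂symLebesgue (Fin q) := by
  obtain ⟨c₁, hc₁⟩ := hX.exists_lintegral_pair hS t
  obtain ⟨c₂, hc₂⟩ := exists_lintegral_invWishartKernel_toBlocks₁₁ (n + 2)
    (schurMatrix_posDef (hS.smul hn) (hV.smul hn) F)
  refine ⟨c₁ * c₂, fun f hf => ?_⟩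
  rw [hc₁ (fun p => f p.1) (hf.comp measurable_fst)]
  simp only
  rw [hc₂ f hf, mul_assoc c₁ c₂]
  rfl

theorem IsIWAR1.ae_posDef (hX : IsIWAR1 P n F S X) (hn : 0 < n) (hS : S.PosDef)
    (hV : (S - F * S * Fᵀ).PosDef) (t : ℕ) : ∀ᵐ ω ∂P, (X t ω).PosDef := by
  obtain ⟨c, hc⟩ := hX.exists_lintegral_state hn hS hV t
  have hset := (Matrix.measurableSet_posDef (ι := Fin q)).compl
  have h := hc ({A | A.PosDef}ᶜ.indicator fun _ => 1) (measurable_const.indicator hset)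
  have h0 (A : Matrix (Fin q) (Fin q) ℝ) : ({A | A.PosDef}ᶜ.indicator fun _ => 1) A *
      invWishartKernel (n + 2) (n • S) A = 0 := by
    by_cases hA : A.PosDef
    · rw [Set.indicator_of_notMem (by simpa using hA), zero_mul]
    · rw [invWishartKernel_of_not_posDef _ _ hA, mul_zero]
  simp only [h0, lintegral_zero, mul_zero] at h
  have hm : Measurable fun ω => ({A : Matrix (Fin q) (Fin q) ℝ | A.PosDef}ᶜ.indicator
      fun _ => (1 : ℝ≥0∞)) (X t ω) := (measurable_const.indicator hset).comp (hX.measurable t)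
  rw [lintegral_eq_zero_iff hm] at h
  filter_upwards [h] with ω hω
  by_contra hcon
  rw [Set.indicator_of_mem (by exact hcon)] at hω
  exact one_ne_zero hω

/-- A property that holds almost surely along the process holds at Lebesgue-almost every positive
definite matrix. -/
theorem IsIWAR1.ae_symLebesgue_of_ae [IsProbabilityMeasure P] (hX : IsIWAR1 P n F S X)
    (hn : 0 < n) (hS : S.PosDef) (hV : (S - F * S * Fᵀ).PosDef) (t : ℕ)
    {p : Matrix (Fin q) (Fin q) ℝ → Prop} (hp : MeasurableSet {A | p A})
    (h : ∀ᵐ ω ∂P, p (X t ω)) : ∀ᵐ A ∂symLebesgue (Fin q), A.PosDef → p A := by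
  obtain ⟨c, hc⟩ := hX.exists_lintegral_state hn hS hV t
  have hind : Measurable ({A | p A}ᶜ.indicator fun _ => (1 : ℝ≥0∞)) :=
    measurable_const.indicator hp.compl
  have h1 := hc (fun _ => 1) measurable_const
  -- Total mass one excludes a zero constant; since the kernel is nonzero on positive definite
  -- matrices, null sets of the law are Lebesgue-null there.
  have hc0 : c ≠ 0 := by
    rintro rfl
    simp at h1
  have h2 := hc _ hind
  have h3 : ∫⁻ ω, ({A | p A}ᶜ.indicator fun _ => (1 : ℝ≥0∞)) (X t ω) ∂P = 0 := by
    refine lintegral_eq_zero_of_ae_eq_zero ?_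
    filter_upwards [h] with ω hω
    exact Set.indicator_of_notMem (by simpa using hω) _
  rw [h3] at h2
  have h4 := (mul_eq_zero.1 h2.symm).resolve_left hc0
  filter_upwards [(lintegral_eq_zero_iff (hind.mul (measurable_invWishartKernel (n + 2) (n • S)))).1
    h4] with A hA hAp
  by_contra hcon
  simp only [Pi.mul_apply] at hA
  rw [Set.indicator_of_mem (by exact hcon), one_mul] at hA
  exact invWishartKernel_ne_zero _ _ hAp hA

/-- The mean is finite for every `n > 0` because the parameter `n + 2` exceeds two. Total mass one
makes the constant times the kernel integral equal to one. -/
theorem IsIWAR1.lintegral_quad_lt_top [IsProbabilityMeasure P] (hX : IsIWAR1 P n F S X)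
    (hn : 0 < n) (hS : S.PosDef) (hV : (S - F * S * Fᵀ).PosDef) (t : ℕ) {v : Fin q → ℝ}
    (hv : v ≠ 0) : ∫⁻ ω, ENNReal.ofReal ((X t ω).quad v) ∂P < ∞ := by
  obtain ⟨c, hc⟩ := hX.exists_lintegral_state hn hS hV t
  have h1 := hc (fun _ => 1) measurable_const
  simp only [lintegral_const, measure_univ, one_mul] at h1
  rw [hc (fun A => ENNReal.ofReal (A.quad v)) (Matrix.measurable_quad v).ennreal_ofReal,
    lintegral_quad_mul_invWishartKernel (by linarith) (hS.smul hn) hv, mul_left_comm, ← h1, mul_one]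
  exact ENNReal.ofReal_lt_top

theorem IsIWAR1.integrable_quad [IsProbabilityMeasure P] (hX : IsIWAR1 P n F S X)
    (hn : 0 < n) (hS : S.PosDef) (hV : (S - F * S * Fᵀ).PosDef) (t : ℕ) {v : Fin q → ℝ}
    (hv : v ≠ 0) : Integrable (fun ω => (X t ω).quad v) P := by
  refine ⟨((Matrix.measurable_quad v).comp (hX.measurable t)).aestronglyMeasurable, ?_⟩
  rw [hasFiniteIntegral_iff_ofReal]
  · exact hX.lintegral_quad_lt_top hn hS hV t hv
  · filter_upwards [hX.ae_posDef hn hS hV t] with ω hω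
    exact hω.posSemidef.quad_nonneg v

/-- The defining identity of conditional expectation, kept in `ℝ≥0∞` so that it precedes
integrability. Indicators `φ` give the set integrals, and `φ = 1` gives integrability of the
regression function. -/
theorem IsIWAR1.lintegral_mul_quad [IsProbabilityMeasure P] (hX : IsIWAR1 P n F S X)
    (hn : 0 < n) (hS : S.PosDef) (hV : (S - F * S * Fᵀ).PosDef) (t : ℕ) {v : Fin q → ℝ}
    (hv : v ≠ 0) {φ : Matrix (Fin q) (Fin q) ℝ → ℝ≥0∞} (hφ : Measurable φ)
    (hφtop : ∀ A, φ A ≠ ∞) :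
    ∫⁻ ω, φ (X t ω) * ENNReal.ofReal ((X (t + 1) ω).quad v) ∂P =
      ∫⁻ ω, φ (X t ω) * ENNReal.ofReal ((iwarCondMean n F S (X t ω)).quad v) ∂P := by
  obtain ⟨c, hc⟩ := hX.exists_lintegral_pair hS t
  rw [hc (fun p => φ p.1 * ENNReal.ofReal (p.2.quad v)) ((hφ.comp measurable_fst).mul
      ((Matrix.measurable_quad v).comp measurable_snd).ennreal_ofReal),
    hc (fun p => φ p.1 * ENNReal.ofReal ((iwarCondMean n F S p.1).quad v))
      ((hφ.comp measurable_fst).mul ((Matrix.measurable_quad v).comp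
        ((measurable_iwarCondMean n F S).comp measurable_fst)).ennreal_ofReal)]
  simp only
  rw [lintegral_quad_toBlocks₂₂_mul_invWishartKernel
    (by rw [Fintype.card_fin]; have : (0 : ℝ) ≤ q := q.cast_nonneg; linarith) (hS.smul hn) F
    (hV.smul hn) hv hφ hφtop]
  -- With `δ = n + 2` the denominator `δ + q - 2` is `n + q`; the numerator `n` is the factor in the
  -- Schur complement.
  have hmean (A : Matrix (Fin q) (Fin q) ℝ) : F * A * Fᵀ +
      ((1 + (A * (n • S)⁻¹).trace) * (n + 2 + (Fintype.card (Fin q) : ℝ) - 2)⁻¹) •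
        n • (S - F * S * Fᵀ) = iwarCondMean n F S A := by
    rw [iwarCondMean, smul_smul, Fintype.card_fin]
    congr 2
    ring
  simp only [hmean]

theorem IsIWAR1.integrable_quad_condMean [IsProbabilityMeasure P] (hX : IsIWAR1 P n F S X)
    (hn : 0 < n) (hS : S.PosDef) (hV : (S - F * S * Fᵀ).PosDef) (t : ℕ) {v : Fin q → ℝ}
    (hv : v ≠ 0) : Integrable (fun ω => (iwarCondMean n F S (X t ω)).quad v) P := by
  refine ⟨((Matrix.measurable_quad v).comp ((measurable_iwarCondMean n F S).comp
    (hX.measurable t))).aestronglyMeasurable, ?_⟩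
  rw [hasFiniteIntegral_iff_ofReal]
  · have h := hX.lintegral_mul_quad hn hS hV t hv (φ := fun _ => 1) measurable_const
      fun _ => ENNReal.one_ne_top
    simp only [one_mul] at h
    rw [← h]
    exact hX.lintegral_quad_lt_top hn hS hV (t + 1) hv
  · filter_upwards [hX.ae_posDef hn hS hV t] with ω hω
    exact (iwarCondMean_posSemidef hn hS hV hω).quad_nonneg v

theorem IsIWAR1.setIntegral_quad [IsProbabilityMeasure P] (hX : IsIWAR1 P n F S X)
    (hn : 0 < n) (hS : S.PosDef) (hV : (S - F * S * Fᵀ).PosDef) (t : ℕ) {v : Fin q → ℝ}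
    (hv : v ≠ 0) {B : Set (Matrix (Fin q) (Fin q) ℝ)} (hB : MeasurableSet B) :
    ∫ ω in X t ⁻¹' B, (iwarCondMean n F S (X t ω)).quad v ∂P =
      ∫ ω in X t ⁻¹' B, (X (t + 1) ω).quad v ∂P := by
  have hs : MeasurableSet (X t ⁻¹' B) := hX.measurable t hB
  rw [integral_eq_lintegral_of_nonneg_ae, integral_eq_lintegral_of_nonneg_ae]
  · have h := hX.lintegral_mul_quad hn hS hV t hv (φ := B.indicator fun _ => 1)
      (measurable_const.indicator hB) fun A => by
        by_cases hA : A ∈ B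
        · simp [hA]
        · simp [hA]
    have hset (g : Ω → ℝ≥0∞) : ∫⁻ ω, (B.indicator fun _ => 1) (X t ω) * g ω ∂P =
        ∫⁻ ω in X t ⁻¹' B, g ω ∂P := by
      rw [← lintegral_indicator hs]
      refine lintegral_congr fun ω => ?_
      by_cases hω : X t ω ∈ B
      · rw [Set.indicator_of_mem hω, Set.indicator_of_mem (by exact hω), one_mul]
      · rw [Set.indicator_of_notMem hω, Set.indicator_of_notMem (by exact hω), zero_mul]
    rw [hset, hset] at h
    rw [h]
  · filter_upwards [ae_restrict_of_ae (hX.ae_posDef hn hS hV (t + 1))] with ω hω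
    exact hω.posSemidef.quad_nonneg v
  · exact (hX.integrable_quad hn hS hV (t + 1) hv).aestronglyMeasurable.restrict
  · filter_upwards [ae_restrict_of_ae (hX.ae_posDef hn hS hV t)] with ω hω
    exact (iwarCondMean_posSemidef hn hS hV hω).quad_nonneg v
  · exact (hX.integrable_quad_condMean hn hS hV t hv).aestronglyMeasurable.restrict

theorem Matrix.single_one_add_single_one_ne_zero {ι : Type*} [DecidableEq ι] (i j : ι) :
    (Pi.single i 1 + Pi.single j 1 : ι → ℝ) ≠ 0 := by
  intro h
  have h1 := congrFun h i
  have h2 : (0 : ℝ) ≤ (Pi.single j 1 : ι → ℝ) i := by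
    rw [Pi.single_apply]
    split_ifs <;> norm_num
  simp only [Pi.add_apply, Pi.single_eq_same, Pi.zero_apply] at h1
  linarith

theorem Matrix.single_one_ne_zero {ι : Type*} [DecidableEq ι] (i : ι) :
    (Pi.single i 1 : ι → ℝ) ≠ 0 := by
  simp

/-- The conditional mean of the process. -/
theorem IsIWAR1.integrable_and_condExp_eq [IsProbabilityMeasure P] (hX : IsIWAR1 P n F S X)
    (hn : 0 < n) (hS : S.PosDef) (hV : (S - F * S * Fᵀ).PosDef) (t : ℕ) (i j : Fin q) :
    Integrable (fun ω => X (t + 1) ω i j) P ∧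
      P[fun ω => X (t + 1) ω i j | MeasurableSpace.comap (X t) inferInstance]
        =ᵐ[P] fun ω => iwarCondMean n F S (X t ω) i j := by
  have hij := Matrix.single_one_add_single_one_ne_zero i j
  have hi := Matrix.single_one_ne_zero i
  have hj := Matrix.single_one_ne_zero j
  -- Polarization needs symmetry, which the states have only almost surely.
  have hpol : (fun ω => X (t + 1) ω i j) =ᵐ[P] fun ω =>
      ((X (t + 1) ω).quad (Pi.single i 1 + Pi.single j 1) - (X (t + 1) ω).quad (Pi.single i 1) -
        (X (t + 1) ω).quad (Pi.single j 1)) / 2 := by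
    filter_upwards [hX.ae_posDef hn hS hV (t + 1)] with ω hω
    exact Matrix.apply_eq_quad hω.transpose_eq i j
  have hpol' : (fun ω => iwarCondMean n F S (X t ω) i j) =ᵐ[P] fun ω =>
      ((iwarCondMean n F S (X t ω)).quad (Pi.single i 1 + Pi.single j 1) -
        (iwarCondMean n F S (X t ω)).quad (Pi.single i 1) -
        (iwarCondMean n F S (X t ω)).quad (Pi.single j 1)) / 2 := by
    filter_upwards [hX.ae_posDef hn hS hV t] with ω hω
    refine Matrix.apply_eq_quad ?_ i j
    simpa [Matrix.IsHermitian] using (iwarCondMean_posSemidef hn hS hV hω).isHermitian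
  have hX1 := hX.integrable_quad hn hS hV (t + 1) hij
  have hX2 := hX.integrable_quad hn hS hV (t + 1) hi
  have hX3 := hX.integrable_quad hn hS hV (t + 1) hj
  have hM1 := hX.integrable_quad_condMean hn hS hV t hij
  have hM2 := hX.integrable_quad_condMean hn hS hV t hi
  have hM3 := hX.integrable_quad_condMean hn hS hV t hj
  have hintX : Integrable (fun ω => X (t + 1) ω i j) P :=
    (((hX1.sub hX2).sub hX3).div_const 2).congr hpol.symm
  have hintM : Integrable (fun ω => iwarCondMean n F S (X t ω) i j) P :=
    (((hM1.sub hM2).sub hM3).div_const 2).congr hpol'.symm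
  refine ⟨hintX, ?_⟩
  have hle : MeasurableSpace.comap (X t) inferInstance ≤ (inferInstance : MeasurableSpace Ω) :=
    (hX.measurable t).comap_le
  refine (ae_eq_condExp_of_forall_setIntegral_eq hle hintX (fun s _ _ => hintM.integrableOn)
    ?_ ?_).symm
  · rintro s ⟨B, hB, rfl⟩ -
    rw [integral_congr_ae (ae_restrict_of_ae hpol), integral_congr_ae (ae_restrict_of_ae hpol'),
      integral_div, integral_div]
    have hsub {f g h : Ω → ℝ} (hf : Integrable f P) (hg : Integrable g P) (hh : Integrable h P) :
        ∫ ω in X t ⁻¹' B, (f ω - g ω - h ω) ∂P = (∫ ω in X t ⁻¹' B, f ω ∂P) -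
          (∫ ω in X t ⁻¹' B, g ω ∂P) - ∫ ω in X t ⁻¹' B, h ω ∂P := by
      rw [← integral_sub hf.integrableOn hg.integrableOn]
      exact integral_sub (hf.sub hg).integrableOn hh.integrableOn
    rw [hsub hM1 hM2 hM3, hsub hX1 hX2 hX3, hX.setIntegral_quad hn hS hV t hij hB,
      hX.setIntegral_quad hn hS hV t hi hB, hX.setIntegral_quad hn hS hV t hj hB]
  · have hm : Measurable[MeasurableSpace.comap (X t) inferInstance]
        fun ω => iwarCondMean n F S (X t ω) i j :=
      ((Matrix.measurable_entry i j).comp (measurable_iwarCondMean n F S)).comp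
        (comap_measurable (X t))
    exact hm.stronglyMeasurable.aestronglyMeasurable

/-- The factor `n / (n + q)` tends to one and the trace is `n⁻¹ tr (A S⁻¹)`, so `F A Fᵀ + (S - F S
Fᵀ)` remains. -/
theorem tendsto_iwarCondMean (F : Matrix (Fin q) (Fin q) ℝ) {S : Matrix (Fin q) (Fin q) ℝ}
    (hS : S.PosDef) (A : Matrix (Fin q) (Fin q) ℝ) :
    Tendsto (fun n : ℝ => iwarCondMean n F S A) atTop (𝓝 (S + F * (A - S) * Fᵀ)) := by
  have hlim : S + F * (A - S) * Fᵀ =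
      F * A * Fᵀ + ((1 : ℝ) * (1 + 0 * (A * S⁻¹).trace)) • (S - F * S * Fᵀ) := by
    rw [zero_mul, add_zero, mul_one, one_smul, Matrix.mul_sub, Matrix.sub_mul]
    abel
  have hc : Tendsto (fun n : ℝ => n / (n + (q : ℝ))) atTop (𝓝 1) := by
    have h : Tendsto (fun n : ℝ => 1 - (q : ℝ) * (n + (q : ℝ))⁻¹) atTop (𝓝 (1 - q * 0)) :=
      ((tendsto_inv_atTop_zero.comp (tendsto_atTop_add_const_right _ _ tendsto_id)).const_mul
        _).const_sub _
    rw [mul_zero, sub_zero] at h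
    refine h.congr' ?_
    filter_upwards [eventually_gt_atTop 0] with n hn
    have : n + (q : ℝ) ≠ 0 := by positivity
    field_simp
    ring
  have h : Tendsto (fun n : ℝ => F * A * Fᵀ + ((n / (n + (q : ℝ))) *
      (1 + n⁻¹ * (A * S⁻¹).trace)) • (S - F * S * Fᵀ)) atTop (𝓝 (S + F * (A - S) * Fᵀ)) := by
    rw [hlim]
    exact ((hc.mul ((tendsto_inv_atTop_zero.mul_const _).const_add 1)).smul_const _).const_add _
  refine h.congr' ?_
  filter_upwards [eventually_gt_atTop 0] with n hn
  have hinv : (n • S)⁻¹ = n⁻¹ • S⁻¹ := by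
    refine inv_eq_right_inv ?_
    rw [Matrix.smul_mul, Matrix.mul_smul, smul_smul, mul_inv_cancel₀ hn.ne', one_smul,
      mul_nonsing_inv _ (isUnit_iff_ne_zero.2 hS.det_pos.ne')]
  rw [iwarCondMean, hinv, Matrix.mul_smul, trace_smul, smul_eq_mul]

end Autoregression

end

/-! ### The conditional mean and its limit as `n → ∞` -/

theorem theorem3 {q : ℕ} (F S : Matrix (Fin q) (Fin q) ℝ)
    (hS : S.PosDef) (hV : (S - F * S * Fᵀ).PosDef) :
    -- the conditional mean of the process
    (∀ (n : ℝ), 0 < n →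
      ∀ (Ω : Type*) [MeasurableSpace Ω] (P : Measure Ω) [IsProbabilityMeasure P]
        (X : ℕ → Ω → Matrix (Fin q) (Fin q) ℝ), IsIWAR1 P n F S X →
      ∀ (t : ℕ) (i j : Fin q),
        Integrable (fun ω => X (t + 1) ω i j) P ∧
        P[fun ω => X (t + 1) ω i j | MeasurableSpace.comap (X t) inferInstance]
          =ᵐ[P] fun ω =>
            (F * X t ω * Fᵀ + ((n / (n + (q : ℝ))) * (1 + (X t ω * (n • S)⁻¹).trace)) •
              (S - F * S * Fᵀ)) i j) ∧
    -- the formula converges at every value of the conditioning matrix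
    (∀ A : Matrix (Fin q) (Fin q) ℝ,
      Tendsto (fun n : ℝ =>
          F * A * Fᵀ + ((n / (n + (q : ℝ))) * (1 + (A * (n • S)⁻¹).trace)) • (S - F * S * Fᵀ))
        atTop (𝓝 (S + F * (A - S) * Fᵀ))) ∧
    -- whatever versions `g k` of the regression functions `A ↦ E[X (t+1) | X t = A]` are chosen
    -- along parameters `n k → ∞`, they converge at Lebesgue-almost every positive definite `A`
    (∀ (n : ℕ → ℝ), (∀ k, 0 < n k) → Tendsto n atTop atTop →
      ∀ (Ω : ℕ → Type*) [∀ k, MeasurableSpace (Ω k)] (P : ∀ k, Measure (Ω k))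
        [∀ k, IsProbabilityMeasure (P k)]
        (X : ∀ k, ℕ → Ω k → Matrix (Fin q) (Fin q) ℝ), (∀ k, IsIWAR1 (P k) (n k) F S (X k)) →
      ∀ (t : ℕ) (g : ℕ → Matrix (Fin q) (Fin q) ℝ → Matrix (Fin q) (Fin q) ℝ),
        (∀ k, Measurable (g k)) →
        (∀ k i j, (P k)[fun ω => X k (t + 1) ω i j |
            MeasurableSpace.comap (X k t) inferInstance]
          =ᵐ[P k] fun ω => g k (X k t ω) i j) →
        ∀ᵐ A ∂(symLebesgue (Fin q)), A.PosDef →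
          Tendsto (fun k => g k A) atTop (𝓝 (S + F * (A - S) * Fᵀ))) := by
  refine ⟨fun n hn Ω _ P _ X hX t i j => hX.integrable_and_condExp_eq hn hS hV t i j,
    fun A => tendsto_iwarCondMean F hS A, ?_⟩
  intro n hn hlim Ω _ P _ X hX t g hg hcond
  -- One exceptional null set for each `k`; as there are countably many, a single null set serves
  -- the whole sequence.
  have key (k : ℕ) : ∀ᵐ A ∂(symLebesgue (Fin q)), A.PosDef →
      ∀ i j, g k A i j = iwarCondMean (n k) F S A i j := by
    refine (hX k).ae_symLebesgue_of_ae (hn k) hS hV t ?_ ?_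
    · have hset : {A : Matrix (Fin q) (Fin q) ℝ | ∀ i j, g k A i j = iwarCondMean (n k) F S A i j} =
          ⋂ i, ⋂ j, {A | g k A i j = iwarCondMean (n k) F S A i j} := by
        ext A
        simp
      rw [hset]
      exact .iInter fun i => .iInter fun j => measurableSet_eq_fun
        ((Matrix.measurable_entry i j).comp (hg k))
        ((Matrix.measurable_entry i j).comp (measurable_iwarCondMean (n k) F S))
    · refine ae_all_iff.2 fun i => ae_all_iff.2 fun j => ?_
      exact (hcond k i j).symm.trans ((hX k).integrable_and_condExp_eq (hn k) hS hV t i j).2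
  filter_upwards [ae_all_iff.2 key] with A hA hAp
  refine ((tendsto_iwarCondMean F hS A).comp hlim).congr fun k => ?_
  ext i j
  exact (hA k hAp i j).symm
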